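/- Fix $d\ge 1$. For a probability measure $G$ on $\mathbb{R}^d$ let $f_G(x)=\int \phi_d(x-\theta)\,dG(\theta)$ with $\phi_d(z)=(2\pi)^{-d/2}e^{-\|z\|^2/2}$, and let $\mathcal{M}$ be the class of all such densities $f_G$. For densities $f,g$ let $\mathfrak{H}^2(f,g)=\int(\sqrt{f}-\sqrt{g})^2\,dx$, and let $\mathfrak{H}(f,g)$ be its non-negative square root. For a non-empty compact set $S\subseteq\mathbb{R}^d$ let $\mathfrak{d}_S(x)=\inf_{u\in S}\|x-u\|$, $S^1=\{x:\mathfrak{d}_S(x)\le 1\}$, and $\mu_p(\mathfrak{d}_S,G)=\left(\int \mathfrak{d}_S(\theta)^p\,dG(\theta)\right)^{1/p}\in[0,\infty]$ for $p>0$. For $n\ge 2$ and $M\ge\sqrt{10\log n}$ define $\epsilon_n(M,S,G)\in[0,\infty]$ by $$\epsilon_n^2(M,S,G)=\mathrm{Vol}(S^1)\frac{M^d}{n}\left(\sqrt{\log n}\right)^{d+2}+(\log n)\inf_{p\ge\frac{d+1}{2\log n}}\left(\frac{2\mu_p(\mathfrak{d}_S,G)}{M}\right)^p .$$ **Theorem.**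 There is a constant $C_d>0$, depending only on $d$, such that the following holds for all $n\ge 2$, all probability measures $G_1,\dots,G_n$ on $\mathbb{R}^d$, all independent random vectors $X_1,\dots,X_n$ with $X_i\sim f_{G_i}$, every non-empty compact $S\subseteq\mathbb{R}^d$, every $M\ge\sqrt{10\log n}$ and all $0<\beta\le\alpha<1$. Write $\bar G_n=(G_1+\dots+G_n)/n$ and $\epsilon_n=\epsilon_n(M,S,\bar G_n)$. If $\hat f_n$ is an estimator based on $X_1,\dots,X_n$ that takes values in $\mathcal{M}$ and satisfies, almost surely, $$\prod_{i=1}^n\frac{\hat f_n(X_i)}{f_{\bar G_n}(X_i)}\ \ge\ \exp\left[\frac{C_d(\beta-\alpha)}{\min(1-\alpha,\beta)}\,n\,\epsilon_n^2\right],\qquad(\ast)$$ then $$\mathbb{P}\left\{\mathfrak{H}(\hat f_n,f_{\bar G_n})\ge\frac{t\,\epsilon_n\sqrt{C_d}}{\sqrt{\min(1-\alpha,\beta)}}\right\}\le 2n^{-t^2}\quad\text{for every }t\ge 1,$$ and $$\mathbb{E}\,\mathfrak{H}^2(\hat f_n,f_{\bar G_n})\le\frac{4C_d}{\min(1-\alpha,\beta)}\,\epsilon_n^2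 .$$ Moreover, $(\ast)$ holds for every nonparametric maximum likelihood estimator, that is, for every $\hat f_n\in\mathcal{M}$ that maximizes $\frac1n\sum_{i=1}^n\log f(X_i)$ over $f\in\mathcal{M}$. -/

import Mathlib

open MeasureTheory ProbabilityTheory
open scoped ENNReal

noncomputable section

/-- The standard Gaussian density on `ℝ^d`. -/
def stdGaussianDensity (d : ℕ) (z : EuclideanSpace ℝ (Fin d)) : ℝ :=
  (2 * Real.pi) ^ (-(d : ℝ) / 2) * Real.exp (-‖z‖ ^ 2 / 2)

/-- The Gaussian location mixture density `f_G(x) = ∫ φ_d(x - θ) dG(θ)`. -/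
def mixtureDensity {d : ℕ} (G : Measure (EuclideanSpace ℝ (Fin d)))
    (x : EuclideanSpace ℝ (Fin d)) : ℝ :=
  ∫ θ, stdGaussianDensity d (x - θ) ∂G

/-- The class of all densities `f_G`, where `G` runs over all probability measures on `ℝ^d`. -/
def mixtureClass (d : ℕ) : Set (EuclideanSpace ℝ (Fin d) → ℝ) :=
  {f | ∃ G : Measure (EuclideanSpace ℝ (Fin d)), IsProbabilityMeasure G ∧ f = mixtureDensity G}

/-- The distribution on `ℝ^d` whose Lebesgue density is `f_G`. -/
def mixtureLaw {d : ℕ} (G : Measure (EuclideanSpace ℝ (Fin d))) :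
    Measure (EuclideanSpace ℝ (Fin d)) :=
  volume.withDensity fun x => ENNReal.ofReal (mixtureDensity G x)

/-- The average `(G_1 + ⋯ + G_n) / n`. -/
def averageMeasure {d n : ℕ} (G : Fin n → Measure (EuclideanSpace ℝ (Fin d))) :
    Measure (EuclideanSpace ℝ (Fin d)) :=
  (n : ℝ≥0∞)⁻¹ • ∑ i, G i

/-- The squared Hellinger distance `∫ (√f - √g)²`. -/
def hellingerSq {d : ℕ} (f g : EuclideanSpace ℝ (Fin d) → ℝ) : ℝ≥0∞ :=
  ∫⁻ x, ENNReal.ofReal ((Real.sqrt (f x) - Real.sqrt (g x)) ^ 2)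

/-- The Hellinger distance. -/
def hellinger {d : ℕ} (f g : EuclideanSpace ℝ (Fin d) → ℝ) : ℝ≥0∞ :=
  hellingerSq f g ^ (1 / 2 : ℝ)

/-- The moment `μ_p(𝔡_S, G) = (∫ 𝔡_S(θ)^p dG(θ))^(1/p)`, possibly infinite, where `𝔡_S` is the
distance to `S`. -/
def distMoment {d : ℕ} (p : ℝ) (S : Set (EuclideanSpace ℝ (Fin d)))
    (G : Measure (EuclideanSpace ℝ (Fin d))) : ℝ≥0∞ :=
  (∫⁻ θ, ENNReal.ofReal (Metric.infDist θ S) ^ p ∂G) ^ (1 / p)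

/-- The squared rate `ε_n²(M, S, G)`; it is infinite if all the moments `μ_p(𝔡_S, G)` in the
infimum are. -/
def rateSq {d : ℕ} (n : ℕ) (M : ℝ) (S : Set (EuclideanSpace ℝ (Fin d)))
    (G : Measure (EuclideanSpace ℝ (Fin d))) : ℝ≥0∞ :=
  volume {x | Metric.infDist x S ≤ 1} *
      ENNReal.ofReal (M ^ d / n * Real.sqrt (Real.log n) ^ (d + 2)) +
    ENNReal.ofReal (Real.log n) *
      ⨅ (p : ℝ) (_ : ((d : ℝ) + 1) / (2 * Real.log n) ≤ p),
        (2 * distMoment p S G / ENNReal.ofReal M) ^ p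

/-- The rate `ε_n(M, S, G)`. -/
def rate {d : ℕ} (n : ℕ) (M : ℝ) (S : Set (EuclideanSpace ℝ (Fin d)))
    (G : Measure (EuclideanSpace ℝ (Fin d))) : ℝ≥0∞ :=
  rateSq n M S G ^ (1 / 2 : ℝ)

/-- `f` is a nonparametric maximum likelihood estimate for the data points `x_1, …, x_n`: it
maximizes `(1/n) ∑ log f(x_i)` over all Gaussian location mixture densities. -/
def IsNPMLE {d n : ℕ} (x : Fin n → EuclideanSpace ℝ (Fin d))
    (f : EuclideanSpace ℝ (Fin d) → ℝ) : Prop :=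
  f ∈ mixtureClass d ∧
    IsMaxOn (fun g : EuclideanSpace ℝ (Fin d) → ℝ => (1 / (n : ℝ)) * ∑ i, Real.log (g (x i)))
      (mixtureClass d) f

/-- The inequality `∏ f(x_i) / g(x_i) ≥ exp (C (β - α) / min (1 - α, β) * n * e)`. The number `e`
may be infinite; then the right side is `exp (-∞) = 0` for `β < α`. -/
def LikelihoodRatioBound {d n : ℕ} (C α β : ℝ) (e : ℝ≥0∞) (x : Fin n → EuclideanSpace ℝ (Fin d))
    (f g : EuclideanSpace ℝ (Fin d) → ℝ) : Prop :=
  EReal.exp (((C * (β - α) / min (1 - α) β * n : ℝ) : EReal) * (e : EReal)) ≤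
    ENNReal.ofReal (∏ i, f (x i) / g (x i))

end

/-! ### Gaussian mixture densities and their laws -/

section GaussianMixtures

variable {d : ℕ}

/-! This is the classical likelihood-ratio argument for sieved maximum likelihood, adapted to data
that may lie far from `S`. Write `g` for the density of the averaged mixing measure, `L = log n`, `R
= s K ε_n² / min (1 - α, β)` and `Γ = n R`, where `s = t²`. Suppose that the estimate `f` has
squared Hellinger distance at least `R` from `g`.

Among the mixing measures at that distance, choose a finite net for the uniform norm on the
`M`-neighbourhood of `S`, with error `n⁻²` (`exists_mixtureDensity_entropy_le`). The logarithm of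
its size is at most a multiple of `n` times the first term of `ε_n²`. For a net element `H` close to
`f`, one has `f ≤ (f_H + h) W` everywhere, where `h = n⁻² · tailWeight` has small integral and `W =
outlierWeight` equals 1 near `S` (`le_add_tailWeight_mul_outlierWeight`). Since `s ≥ 1`, the
assumption on the likelihood forces `∏ f / g ≥ exp (βΓ - αΓ)`. Hence either `∏ √((f_H + h) / g) ≥
exp (-αΓ/2)` for some `H` in the net, or `∏ W^(1/(2L)) ≥ exp (βΓ/(2L))`.

Both events are rare by Markov's inequality for products. In the first, the mean of the square root
is a Hellinger affinity, at most `1 - R/2` up to the effect of `h`, so each `H` costs about `exp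
(-(1 - α)Γ/2)`, which beats the size of the net (`measure_exp_le_prod_sqrt_ratio_le`). In the
second, the power `1/(2L)` turns the factor `n²` in `W` into `e`, and what remains is controlled by
the moments of the distance to `S` and a Gaussian tail (`measure_exp_le_prod_outlierWeight_le`).
Each event has probability at most `n^(-s)`. The bound in mean follows by summing the tails, and a
maximum likelihood estimate qualifies because its likelihood ratio is at least 1. -/

lemma stdGaussianDensity_pos (z : EuclideanSpace ℝ (Fin d)) : 0 < stdGaussianDensity d z := by
  unfold stdGaussianDensity; positivity

lemma two_pi_rpow_le_one (d : ℕ) : (2 * Real.pi) ^ (-(d : ℝ) / 2) ≤ 1 := by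
  apply Real.rpow_le_one_of_one_le_of_nonpos
  · linarith [Real.pi_gt_three]
  · have : (0 : ℝ) ≤ d := by positivity
    linarith

lemma stdGaussianDensity_le_one (z : EuclideanSpace ℝ (Fin d)) : stdGaussianDensity d z ≤ 1 := by
  unfold stdGaussianDensity
  refine mul_le_one₀ (two_pi_rpow_le_one d) (by positivity) ?_
  rw [Real.exp_le_one_iff]
  nlinarith [sq_nonneg ‖z‖]

lemma continuous_stdGaussianDensity : Continuous (stdGaussianDensity d) := by
  unfold stdGaussianDensity; fun_prop

lemma lintegral_stdGaussianDensity :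
    ∫⁻ z, ENNReal.ofReal (stdGaussianDensity d z) = 1 := by
  have h1 : ∫ z, stdGaussianDensity d z = 1 := by
    unfold stdGaussianDensity
    rw [integral_const_mul]
    have := GaussianFourier.integral_rexp_neg_mul_sq_norm
      (V := EuclideanSpace ℝ (Fin d)) (b := 1 / 2) (by norm_num)
    rw [show (fun z : EuclideanSpace ℝ (Fin d) => Real.exp (-‖z‖ ^ 2 / 2))
      = fun z => Real.exp (-(1 / 2) * ‖z‖ ^ 2) by ext z; congr 1; ring, this]
    rw [finrank_euclideanSpace_fin, show Real.pi / (1 / 2) = 2 * Real.pi by ring,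
      ← Real.rpow_add (by positivity)]
    rw [show -(d : ℝ) / 2 + d / 2 = 0 by ring, Real.rpow_zero]
  have h2 : Integrable (stdGaussianDensity d) := by
    -- The Bochner integral of a non-integrable function is 0, so the value 1 forces integrability.
    by_contra h
    rw [integral_undef h] at h1
    exact zero_ne_one h1
  rw [← ofReal_integral_eq_lintegral_ofReal h2 (ae_of_all _ fun z => (stdGaussianDensity_pos z).le),
    h1, ENNReal.ofReal_one]

variable (G : Measure (EuclideanSpace ℝ (Fin d)))

lemma integrable_stdGaussianDensity_sub [IsFiniteMeasure G] (x : EuclideanSpace ℝ (Fin d)) :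
    Integrable (fun θ => stdGaussianDensity d (x - θ)) G := by
  refine Integrable.of_bound (C := 1) ?_ (ae_of_all _ fun θ => ?_)
  · exact (continuous_stdGaussianDensity.comp (by fun_prop)).aestronglyMeasurable
  · rw [Real.norm_of_nonneg (stdGaussianDensity_pos _).le]
    exact stdGaussianDensity_le_one _

lemma mixtureDensity_nonneg (x : EuclideanSpace ℝ (Fin d)) : 0 ≤ mixtureDensity G x :=
  integral_nonneg fun _ => (stdGaussianDensity_pos _).le

lemma ofReal_mixtureDensity [IsFiniteMeasure G] (x : EuclideanSpace ℝ (Fin d)) :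
    ENNReal.ofReal (mixtureDensity G x) =
      ∫⁻ θ, ENNReal.ofReal (stdGaussianDensity d (x - θ)) ∂G :=
  ofReal_integral_eq_lintegral_ofReal (integrable_stdGaussianDensity_sub G x)
    (ae_of_all _ fun _ => (stdGaussianDensity_pos _).le)

lemma mixtureDensity_pos [IsProbabilityMeasure G] (x : EuclideanSpace ℝ (Fin d)) :
    0 < mixtureDensity G x := by
  unfold mixtureDensity
  rw [integral_pos_iff_support_of_nonneg (fun _ => (stdGaussianDensity_pos _).le)
    (integrable_stdGaussianDensity_sub G x)]
  have : Function.support (fun θ => stdGaussianDensity d (x - θ)) = Set.univ :=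
    Set.eq_univ_of_forall fun θ => (stdGaussianDensity_pos _).ne'
  simp [this]

lemma mixtureDensity_le_one [IsProbabilityMeasure G] (x : EuclideanSpace ℝ (Fin d)) :
    mixtureDensity G x ≤ 1 := by
  have := integral_mono (integrable_stdGaussianDensity_sub G x) (integrable_const (1 : ℝ))
    fun θ => stdGaussianDensity_le_one (x - θ)
  simpa [mixtureDensity] using this

lemma continuous_mixtureDensity [IsFiniteMeasure G] : Continuous (mixtureDensity G) := by
  refine continuous_of_dominated (bound := fun _ => 1) (fun x => ?_) (fun x => ?_)
    (integrable_const _) (ae_of_all _ fun θ => ?_)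
  · exact (integrable_stdGaussianDensity_sub G x).aestronglyMeasurable
  · refine ae_of_all _ fun θ => ?_
    rw [Real.norm_of_nonneg (stdGaussianDensity_pos _).le]
    exact stdGaussianDensity_le_one _
  · exact continuous_stdGaussianDensity.comp (by fun_prop)

lemma lintegral_mixtureLaw [IsFiniteMeasure G] {g : EuclideanSpace ℝ (Fin d) → ℝ≥0∞}
    (hg : Measurable g) :
    ∫⁻ x, g x ∂(mixtureLaw G) = ∫⁻ x, ENNReal.ofReal (mixtureDensity G x) * g x := by
  unfold mixtureLaw
  rw [lintegral_withDensity_eq_lintegral_mul _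
    (continuous_mixtureDensity G).measurable.ennreal_ofReal hg]
  rfl

/-- For a probability measure `G` this is the law of `θ + Z` with `θ ∼ G` and `Z` an independent
standard Gaussian: Tonelli, then translation invariance of Lebesgue measure. -/
lemma lintegral_mixtureLaw_eq_lintegral_lintegral [IsFiniteMeasure G]
    {g : EuclideanSpace ℝ (Fin d) → ℝ≥0∞} (hg : Measurable g) :
    ∫⁻ x, g x ∂(mixtureLaw G) =
      ∫⁻ θ, ∫⁻ z, ENNReal.ofReal (stdGaussianDensity d z) * g (θ + z) ∂volume ∂G := by
  have hm : Measurable fun p : EuclideanSpace ℝ (Fin d) × EuclideanSpace ℝ (Fin d) =>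
      ENNReal.ofReal (stdGaussianDensity d (p.1 - p.2)) * g p.1 :=
    ((continuous_stdGaussianDensity.comp (by fun_prop)).measurable.ennreal_ofReal).mul
      (hg.comp measurable_fst)
  rw [lintegral_mixtureLaw G hg]
  have h1 : ∀ x, ENNReal.ofReal (mixtureDensity G x) * g x =
      ∫⁻ θ, ENNReal.ofReal (stdGaussianDensity d (x - θ)) * g x ∂G := by
    intro x
    rw [ofReal_mixtureDensity, lintegral_mul_const]
    exact (continuous_stdGaussianDensity.comp (by fun_prop)).measurable.ennreal_ofReal
  simp_rw [h1]
  rw [lintegral_lintegral_swap hm.aemeasurable]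
  refine lintegral_congr fun θ => ?_
  rw [← lintegral_add_left_eq_self _ θ]
  simp

lemma isProbabilityMeasure_mixtureLaw [IsProbabilityMeasure G] :
    IsProbabilityMeasure (mixtureLaw G) := by
  constructor
  have := lintegral_mixtureLaw_eq_lintegral_lintegral G (g := fun _ => 1) measurable_const
  simpa [lintegral_stdGaussianDensity] using this

lemma lintegral_mixtureDensity [IsProbabilityMeasure G] :
    ∫⁻ x, ENNReal.ofReal (mixtureDensity G x) = 1 := by
  have := lintegral_mixtureLaw G (g := fun _ => 1) measurable_const
  have := isProbabilityMeasure_mixtureLaw G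
  simp_all

end GaussianMixtures

/-! ### Averaging the mixing measures -/

section Averages

variable {d n : ℕ} (G : Fin n → Measure (EuclideanSpace ℝ (Fin d)))

lemma isProbabilityMeasure_averageMeasure (hn : n ≠ 0) (hG : ∀ i, IsProbabilityMeasure (G i)) :
    IsProbabilityMeasure (averageMeasure G) := by
  constructor
  simp only [averageMeasure, Measure.smul_apply, Measure.coe_finsetSum, Finset.sum_apply,
    measure_univ, Finset.sum_const, Finset.card_univ, Fintype.card_fin, smul_eq_mul, nsmul_eq_mul,
    mul_one]
  exact ENNReal.inv_mul_cancel (by exact_mod_cast hn) (ENNReal.natCast_ne_top n)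

lemma sum_mixtureDensity (hn : n ≠ 0) (hG : ∀ i, IsProbabilityMeasure (G i))
    (x : EuclideanSpace ℝ (Fin d)) :
    ∑ i, ENNReal.ofReal (mixtureDensity (G i) x) =
      n * ENNReal.ofReal (mixtureDensity (averageMeasure G) x) := by
  have := isProbabilityMeasure_averageMeasure G hn hG
  simp_rw [ofReal_mixtureDensity]
  rw [averageMeasure, lintegral_smul_measure, lintegral_finsetSum_measure, smul_eq_mul,
    ← mul_assoc, ENNReal.mul_inv_cancel (by exact_mod_cast hn) (ENNReal.natCast_ne_top n), one_mul]

/-- The density `f_G` is linear in `G`. This is why only the averaged measure enters the theorem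
although the observations need not be identically distributed. -/
lemma sum_lintegral_mixtureLaw (hn : n ≠ 0) (hG : ∀ i, IsProbabilityMeasure (G i))
    {g : EuclideanSpace ℝ (Fin d) → ℝ≥0∞} (hg : Measurable g) :
    ∑ i, ∫⁻ x, g x ∂(mixtureLaw (G i)) = n * ∫⁻ x, g x ∂(mixtureLaw (averageMeasure G)) := by
  have := isProbabilityMeasure_averageMeasure G hn hG
  have hm : ∀ (H : Measure (EuclideanSpace ℝ (Fin d))) [IsProbabilityMeasure H],
      Measurable fun x => ENNReal.ofReal (mixtureDensity H x) * g x :=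
    fun H _ => (continuous_mixtureDensity H).measurable.ennreal_ofReal.mul hg
  simp_rw [fun i => lintegral_mixtureLaw (G i) hg]
  rw [lintegral_mixtureLaw _ hg, ← lintegral_finsetSum _ fun i _ => hm (G i),
    ← lintegral_const_mul _ (hm _)]
  refine lintegral_congr fun x => ?_
  rw [← Finset.sum_mul, sum_mixtureDensity G hn hG, mul_assoc]

end Averages

/-! ### Hellinger distance and affinity -/

section Hellinger

variable {d : ℕ}

/-- Expand the square. The additive form avoids truncated subtraction in `ℝ≥0∞`. -/
lemma hellingerSq_add_affinity {f g : EuclideanSpace ℝ (Fin d) → ℝ} (hf : ∀ x, 0 ≤ f x)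
    (hg : ∀ x, 0 ≤ g x) (hfm : Measurable f) (hgm : Measurable g)
    (hf1 : ∫⁻ x, ENNReal.ofReal (f x) = 1) (hg1 : ∫⁻ x, ENNReal.ofReal (g x) = 1) :
    hellingerSq f g + 2 * ∫⁻ x, ENNReal.ofReal (√(f x) * √(g x)) = 2 := by
  have hm : Measurable fun x => ENNReal.ofReal (√(f x) * √(g x)) := by fun_prop
  unfold hellingerSq
  have h2 : ∫⁻ x, (ENNReal.ofReal (f x) + ENNReal.ofReal (g x)) = 2 := by
    rw [lintegral_add_right _ hgm.ennreal_ofReal, hf1, hg1, one_add_one_eq_two]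
  rw [← lintegral_const_mul _ hm, ← lintegral_add_right _ (hm.const_mul 2)]
  refine Eq.trans ?_ h2
  refine lintegral_congr fun x => ?_
  rw [← ENNReal.ofReal_ofNat 2, ← ENNReal.ofReal_mul (by norm_num),
    ← ENNReal.ofReal_add (by positivity) (by positivity), ← ENNReal.ofReal_add (hf x) (hg x)]
  congr 1
  nlinarith [Real.sq_sqrt (hf x), Real.sq_sqrt (hg x)]

lemma hellingerSq_le_two {f g : EuclideanSpace ℝ (Fin d) → ℝ} (hf : ∀ x, 0 ≤ f x)
    (hg : ∀ x, 0 ≤ g x) (hfm : Measurable f) (hgm : Measurable g)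
    (hf1 : ∫⁻ x, ENNReal.ofReal (f x) = 1) (hg1 : ∫⁻ x, ENNReal.ofReal (g x) = 1) :
    hellingerSq f g ≤ 2 :=
  (self_le_add_right _ _).trans_eq (hellingerSq_add_affinity hf hg hfm hgm hf1 hg1)

end Hellinger

/-! ### Finite-rank approximation of the Gaussian kernel -/

open scoped Nat

noncomputable section

/-- The coefficients of the expansion `exp (-(y - u)² / 2) = ∑ k, a_k(y) a_k(u)`. -/
def gaussianFeature (k : ℕ) (y : ℝ) : ℝ :=
  Real.exp (-y ^ 2 / 2) * y ^ k / √(k ! : ℝ)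

/-- The product features on `ℝ^d`. -/
def gaussianProductFeature {d m : ℕ} (κ : Fin d → Fin m) (z : EuclideanSpace ℝ (Fin d)) : ℝ :=
  ∏ i, gaussianFeature (κ i) (z i)

end

lemma gaussianFeature_mul (k : ℕ) (y u : ℝ) :
    gaussianFeature k y * gaussianFeature k u =
      Real.exp (-(y ^ 2 + u ^ 2) / 2) * ((y * u) ^ k / k !) := by
  have h : √(k ! : ℝ) * √(k ! : ℝ) = k ! := Real.mul_self_sqrt (by positivity)
  unfold gaussianFeature
  rw [div_mul_div_comm, h, mul_pow, show -(y ^ 2 + u ^ 2) / 2 = -y ^ 2 / 2 + -u ^ 2 / 2 by ring,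
    Real.exp_add]
  ring

lemma gaussianFeature_sq (k : ℕ) (y : ℝ) :
    gaussianFeature k y ^ 2 = Real.exp (-y ^ 2) * ((y ^ 2) ^ k / k !) := by
  rw [pow_two, gaussianFeature_mul]
  congr 2 <;> ring

lemma hasSum_gaussianFeature_mul (y u : ℝ) :
    HasSum (fun k => gaussianFeature k y * gaussianFeature k u) (Real.exp (-(y - u) ^ 2 / 2)) := by
  have h := NormedSpace.expSeries_div_hasSum_exp (y * u)
  rw [← Real.exp_eq_exp_ℝ] at h
  have h' := h.mul_left (Real.exp (-(y ^ 2 + u ^ 2) / 2))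
  rw [← Real.exp_add, show -(y ^ 2 + u ^ 2) / 2 + y * u = -(y - u) ^ 2 / 2 by ring] at h'
  simpa only [gaussianFeature_mul] using h'

/-- On the diagonal `u = y` the kernel equals 1, so the feature vector is a unit vector in `ℓ²`. -/
lemma sum_gaussianFeature_sq_le (s : Finset ℕ) (y : ℝ) : ∑ k ∈ s, gaussianFeature k y ^ 2 ≤ 1 := by
  have h := hasSum_gaussianFeature_mul y y
  simp only [sub_self, ne_eq, OfNat.ofNat_ne_zero, not_false_eq_true, zero_pow, neg_zero,
    zero_div, Real.exp_zero, ← pow_two] at h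
  exact sum_le_hasSum s (fun _ _ => sq_nonneg _) h

lemma abs_gaussianFeature_le_one (k : ℕ) (y : ℝ) : |gaussianFeature k y| ≤ 1 := by
  have := sum_gaussianFeature_sq_le {k} y
  rw [Finset.sum_singleton] at this
  exact (sq_le_one_iff_abs_le_one _).1 this

/-- The squared features are the Poisson weights of mean `y²`. This is the Chernoff bound obtained
by inserting `e^(k - m) ≥ 1`, with `e - 1` rounded up to 2. -/
lemma sum_Ico_gaussianFeature_sq_le (m N : ℕ) (y : ℝ) :
    ∑ k ∈ Finset.Ico m N, gaussianFeature k y ^ 2 ≤ Real.exp (2 * y ^ 2 - m) := by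
  have h1 : ∀ k ∈ Finset.Ico m N, gaussianFeature k y ^ 2 ≤
      Real.exp (-y ^ 2 - m) * ((Real.exp 1 * y ^ 2) ^ k / k !) := by
    intro k hk
    rw [gaussianFeature_sq, mul_pow, ← Real.exp_nat_mul, mul_one, mul_div_assoc, ← mul_assoc,
      ← Real.exp_add]
    gcongr
    have : (m : ℝ) ≤ k := by exact_mod_cast (Finset.mem_Ico.1 hk).1
    linarith
  have h2 : ∑ k ∈ Finset.Ico m N, (Real.exp 1 * y ^ 2) ^ k / (k ! : ℝ) ≤
      Real.exp (Real.exp 1 * y ^ 2) := by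
    refine le_trans (Finset.sum_le_sum_of_subset_of_nonneg ?_ fun _ _ _ => by positivity)
      (Real.sum_le_exp_of_nonneg (by positivity) N)
    intro k hk
    exact Finset.mem_range.2 (Finset.mem_Ico.1 hk).2
  calc _ ≤ _ := Finset.sum_le_sum h1
    _ = Real.exp (-y ^ 2 - m) * ∑ k ∈ Finset.Ico m N, (Real.exp 1 * y ^ 2) ^ k / (k ! : ℝ) := by
        rw [Finset.mul_sum]
    _ ≤ Real.exp (-y ^ 2 - m) * Real.exp (Real.exp 1 * y ^ 2) := by gcongr
    _ ≤ _ := by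
        rw [← Real.exp_add, Real.exp_le_exp]
        nlinarith [Real.exp_one_lt_d9, sq_nonneg y]

lemma abs_sum_gaussianFeature_mul_le (s : Finset ℕ) (y u : ℝ) :
    |∑ k ∈ s, gaussianFeature k y * gaussianFeature k u| ≤
      √(∑ k ∈ s, gaussianFeature k y ^ 2) := by
  refine Real.abs_le_sqrt ((Finset.sum_mul_sq_le_sq_mul_sq _ _ _).trans ?_)
  exact mul_le_of_le_one_right (Finset.sum_nonneg fun _ _ => sq_nonneg _)
    (sum_gaussianFeature_sq_le s u)

/-- By Cauchy–Schwarz only the tail of the features at `y` matters, since those at `u` have norm at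
most 1. The bound is therefore uniform in `u`, and the mixing measures never have to be truncated.
-/
lemma abs_exp_sub_sum_gaussianFeature_le (m : ℕ) {y a : ℝ} (hy : |y| ≤ a) (u : ℝ) :
    |Real.exp (-(y - u) ^ 2 / 2) -
      ∑ k ∈ Finset.range m, gaussianFeature k y * gaussianFeature k u| ≤
      Real.exp (a ^ 2 - m / 2) := by
  have h := ((hasSum_gaussianFeature_mul y u).tendsto_sum_nat.sub_const
    (∑ k ∈ Finset.range m, gaussianFeature k y * gaussianFeature k u)).abs
  refine le_of_tendsto h (Filter.eventually_atTop.2 ⟨m, fun N hN => ?_⟩)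
  rw [← Finset.sum_Ico_eq_sub _ hN]
  refine (abs_sum_gaussianFeature_mul_le _ y u).trans (Real.sqrt_le_iff.2 ⟨by positivity, ?_⟩)
  refine (sum_Ico_gaussianFeature_sq_le m N y).trans ?_
  rw [← Real.exp_nat_mul, Real.exp_le_exp]
  have : y ^ 2 ≤ a ^ 2 := sq_le_sq' (by linarith [neg_abs_le y]) (by linarith [le_abs_self y])
  push_cast
  linarith

/-- Replace the factors one at a time. -/
lemma abs_prod_sub_prod_le {ι : Type*} (s : Finset ι) {a b : ι → ℝ} {δ : ℝ}
    (ha : ∀ i, |a i| ≤ 1) (hb : ∀ i, |b i| ≤ 1) (hab : ∀ i, |a i - b i| ≤ δ) :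
    |∏ i ∈ s, a i - ∏ i ∈ s, b i| ≤ s.card * δ := by
  classical
  induction s using Finset.induction_on with
  | empty => simp
  | insert j s hj ih =>
    rw [Finset.prod_insert hj, Finset.prod_insert hj, Finset.card_insert_of_notMem hj]
    have h1 : |∏ i ∈ s, b i| ≤ 1 := by
      rw [Finset.abs_prod]
      exact Finset.prod_le_one (fun _ _ => abs_nonneg _) fun i _ => hb i
    calc |a j * ∏ i ∈ s, a i - b j * ∏ i ∈ s, b i|
        = |a j * (∏ i ∈ s, a i - ∏ i ∈ s, b i) + (a j - b j) * ∏ i ∈ s, b i| := by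
          congr 1; ring
      _ ≤ |a j| * |∏ i ∈ s, a i - ∏ i ∈ s, b i| + |a j - b j| * |∏ i ∈ s, b i| := by
          rw [← abs_mul, ← abs_mul]; exact abs_add_le _ _
      _ ≤ 1 * (s.card * δ) + δ * 1 := by
          refine add_le_add (mul_le_mul (ha j) ih (abs_nonneg _) zero_le_one)
            (mul_le_mul (hab j) h1 (abs_nonneg _) ((abs_nonneg _).trans (hab j)))
      _ = _ := by push_cast; ring

section Expansion

variable {d : ℕ}

lemma abs_gaussianProductFeature_le_one {m : ℕ} (κ : Fin d → Fin m)
    (z : EuclideanSpace ℝ (Fin d)) : |gaussianProductFeature κ z| ≤ 1 := by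
  rw [gaussianProductFeature, Finset.abs_prod]
  exact Finset.prod_le_one (fun _ _ => abs_nonneg _) fun i _ => abs_gaussianFeature_le_one _ _

lemma continuous_gaussianProductFeature {m : ℕ} (κ : Fin d → Fin m) :
    Continuous (gaussianProductFeature κ) := by
  unfold gaussianProductFeature gaussianFeature
  fun_prop

lemma abs_exp_sub_sum_gaussianProductFeature_le (m : ℕ) {a : ℝ}
    {y : EuclideanSpace ℝ (Fin d)} (hy : ‖y‖ ≤ a) (u : EuclideanSpace ℝ (Fin d)) :
    |Real.exp (-‖y - u‖ ^ 2 / 2) -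
      ∑ κ : Fin d → Fin m, gaussianProductFeature κ y * gaussianProductFeature κ u| ≤
      d * Real.exp (a ^ 2 - m / 2) := by
  have h1 : Real.exp (-‖y - u‖ ^ 2 / 2) = ∏ i, Real.exp (-(y i - u i) ^ 2 / 2) := by
    rw [EuclideanSpace.norm_sq_eq, ← Real.exp_sum]
    congr 1
    simp [neg_div, Finset.sum_div]
  -- The sum over multi-indices factorises over coordinates, as the kernel does.
  have h2 : ∑ κ : Fin d → Fin m, gaussianProductFeature κ y * gaussianProductFeature κ u =
      ∏ i, ∑ k ∈ Finset.range m, gaussianFeature k (y i) * gaussianFeature k (u i) := by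
    simp_rw [Finset.sum_range, Finset.prod_univ_sum, gaussianProductFeature,
      ← Finset.prod_mul_distrib]
    rw [Fintype.piFinset_univ]
  rw [h1, h2]
  refine (abs_prod_sub_prod_le Finset.univ (δ := Real.exp (a ^ 2 - m / 2))
    (fun i => ?_) (fun i => ?_) fun i => ?_).trans (by simp)
  · rw [abs_of_pos (Real.exp_pos _), Real.exp_le_one_iff]
    nlinarith [sq_nonneg (y i - u i)]
  · refine (abs_sum_gaussianFeature_mul_le _ _ _).trans ?_
    rw [← Real.sqrt_one]
    exact Real.sqrt_le_sqrt (sum_gaussianFeature_sq_le _ _)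
  · refine abs_exp_sub_sum_gaussianFeature_le m ?_ _
    exact (PiLp.norm_apply_le y i).trans hy

lemma integrable_gaussianProductFeature {m : ℕ} (κ : Fin d → Fin m)
    (G : Measure (EuclideanSpace ℝ (Fin d))) [IsFiniteMeasure G]
    (x₀ : EuclideanSpace ℝ (Fin d)) :
    Integrable (fun θ => gaussianProductFeature κ (θ - x₀)) G :=
  Integrable.of_bound (C := 1)
    ((continuous_gaussianProductFeature κ).comp (by fun_prop)).aestronglyMeasurable
    (ae_of_all _ fun _ => abs_gaussianProductFeature_le_one _ _)

lemma abs_integral_gaussianProductFeature_le_one {m : ℕ} (κ : Fin d → Fin m)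
    (G : Measure (EuclideanSpace ℝ (Fin d))) [IsProbabilityMeasure G]
    (x₀ : EuclideanSpace ℝ (Fin d)) :
    |∫ θ, gaussianProductFeature κ (θ - x₀) ∂G| ≤ 1 := by
  have := norm_integral_le_of_norm_le_const (μ := G) (C := 1)
    (f := fun θ => gaussianProductFeature κ (θ - x₀))
    (ae_of_all _ fun θ => abs_gaussianProductFeature_le_one κ (θ - x₀))
  simpa using this

lemma abs_integral_exp_sub_sum_le (m : ℕ) {a : ℝ} {x x₀ : EuclideanSpace ℝ (Fin d)}
    (hx : ‖x - x₀‖ ≤ a) (G : Measure (EuclideanSpace ℝ (Fin d))) [IsProbabilityMeasure G] :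
    |∫ θ, Real.exp (-‖x - θ‖ ^ 2 / 2) ∂G -
      ∑ κ : Fin d → Fin m, gaussianProductFeature κ (x - x₀) *
        ∫ θ, gaussianProductFeature κ (θ - x₀) ∂G| ≤ d * Real.exp (a ^ 2 - m / 2) := by
  have hi : Integrable (fun θ => Real.exp (-‖x - θ‖ ^ 2 / 2)) G := by
    refine Integrable.of_bound (C := 1) (Continuous.aestronglyMeasurable (by fun_prop))
      (ae_of_all _ fun θ => ?_)
    rw [Real.norm_of_nonneg (by positivity), Real.exp_le_one_iff]
    nlinarith [sq_nonneg ‖x - θ‖]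
  have hs : Integrable (fun θ => ∑ κ : Fin d → Fin m, gaussianProductFeature κ (x - x₀) *
      gaussianProductFeature κ (θ - x₀)) G :=
    integrable_finsetSum _ fun κ _ => (integrable_gaussianProductFeature κ G x₀).const_mul _
  simp_rw [← integral_const_mul]
  rw [← integral_finsetSum _ fun κ _ => (integrable_gaussianProductFeature κ G x₀).const_mul _,
    ← integral_sub hi hs]
  have := norm_integral_le_of_norm_le_const (μ := G) (C := d * Real.exp (a ^ 2 - m / 2))
    (f := fun θ => Real.exp (-‖x - θ‖ ^ 2 / 2) -
      ∑ κ : Fin d → Fin m, gaussianProductFeature κ (x - x₀) *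
        gaussianProductFeature κ (θ - x₀)) (ae_of_all _ fun θ => ?_)
  · simpa using this
  · have := abs_exp_sub_sum_gaussianProductFeature_le m hx (θ - x₀)
    rwa [sub_sub_sub_cancel_right] at this

/-- Near `x₀` a mixture density is determined, up to the truncation error, by `m ^ d` generalised
moments of its mixing measure. The entropy bound thus reduces to quantising finitely many numbers in
`[-1, 1]`. -/
lemma abs_mixtureDensity_sub_le (m : ℕ) {a w : ℝ} {x x₀ : EuclideanSpace ℝ (Fin d)}
    (hx : ‖x - x₀‖ ≤ a) (G H : Measure (EuclideanSpace ℝ (Fin d))) [IsProbabilityMeasure G]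
    [IsProbabilityMeasure H]
    (hGH : ∀ κ : Fin d → Fin m, |∫ θ, gaussianProductFeature κ (θ - x₀) ∂G -
      ∫ θ, gaussianProductFeature κ (θ - x₀) ∂H| ≤ w) :
    |mixtureDensity G x - mixtureDensity H x| ≤
      2 * d * Real.exp (a ^ 2 - m / 2) + m ^ d * w := by
  have hG := abs_integral_exp_sub_sum_le m hx G
  have hH := abs_integral_exp_sub_sum_le m hx H
  have hS : |∑ κ : Fin d → Fin m, gaussianProductFeature κ (x - x₀) *
        ∫ θ, gaussianProductFeature κ (θ - x₀) ∂G -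
      ∑ κ : Fin d → Fin m, gaussianProductFeature κ (x - x₀) *
        ∫ θ, gaussianProductFeature κ (θ - x₀) ∂H| ≤ m ^ d * w := by
    rw [← Finset.sum_sub_distrib]
    refine (Finset.abs_sum_le_sum_abs _ _).trans ?_
    have : ∀ κ ∈ (Finset.univ : Finset (Fin d → Fin m)),
        |gaussianProductFeature κ (x - x₀) * ∫ θ, gaussianProductFeature κ (θ - x₀) ∂G -
          gaussianProductFeature κ (x - x₀) * ∫ θ, gaussianProductFeature κ (θ - x₀) ∂H| ≤ w := by
      intro κ _
      rw [← mul_sub, abs_mul]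
      exact (mul_le_of_le_one_left (abs_nonneg _) (abs_gaussianProductFeature_le_one _ _)).trans
        (hGH κ)
    simpa using Finset.sum_le_card_nsmul _ _ _ this
  set I := ∫ θ, Real.exp (-‖x - θ‖ ^ 2 / 2) ∂G
  set J := ∫ θ, Real.exp (-‖x - θ‖ ^ 2 / 2) ∂H
  have hIJ : |I - J| ≤ 2 * d * Real.exp (a ^ 2 - m / 2) + m ^ d * w := by
    rw [abs_le] at *
    constructor <;> linarith [hG.1, hG.2, hH.1, hH.2, hS.1, hS.2]
  have e : mixtureDensity G x - mixtureDensity H x =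
      (2 * Real.pi) ^ (-(d : ℝ) / 2) * (I - J) := by
    simp only [mixtureDensity, stdGaussianDensity, integral_const_mul, I, J]
    ring
  rw [e, abs_mul, abs_of_nonneg (by positivity)]
  exact (mul_le_of_le_one_left (abs_nonneg _) (two_pi_rpow_le_one d)).trans hIJ

end Expansion

/-! ### Finite nets by quantisation -/

/-- Quantising finitely many coordinates in `[-1, 1]`. -/
lemma exists_finset_forall_abs_sub_le {α J : Type*} [Fintype J] (c : α → J → ℝ)
    (hc : ∀ f j, |c f j| ≤ 1) {w : ℝ} (hw : 0 < w) (F : Set α) :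
    ∃ T : Finset α, ↑T ⊆ F ∧ (T.card : ℝ) ≤ (2 / w + 2) ^ Fintype.card J ∧
      ∀ f ∈ F, ∃ g ∈ T, ∀ j, |c f j - c g j| ≤ w := by
  classical
  let q : α → J → ℤ := fun f j => ⌊c f j / w⌋
  let B : Finset (J → ℤ) := Fintype.piFinset fun _ => Finset.Icc ⌊-1 / w⌋ ⌊1 / w⌋
  have hq : ∀ f, q f ∈ B := by
    intro f
    refine Fintype.mem_piFinset.2 fun j => Finset.mem_Icc.2 ⟨?_, ?_⟩
    · refine Int.floor_le_floor (div_le_div_of_nonneg_right ?_ hw.le)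
      exact (abs_le.1 (hc f j)).1
    · refine Int.floor_le_floor (div_le_div_of_nonneg_right ?_ hw.le)
      exact (abs_le.1 (hc f j)).2
  have hB : (B.card : ℝ) ≤ (2 / w + 2) ^ Fintype.card J := by
    rw [Fintype.card_piFinset, Finset.prod_const, Finset.card_univ, Int.card_Icc]
    push_cast
    gcongr
    have h1 := Int.floor_le (1 / w)
    have h2 := Int.lt_floor_add_one (-1 / w)
    have h3 : ⌊-1 / w⌋ ≤ ⌊1 / w⌋ := Int.floor_le_floor (by gcongr; norm_num)
    have h4 : ((⌊1 / w⌋ + 1 - ⌊-1 / w⌋).toNat : ℝ) = ⌊1 / w⌋ + 1 - ⌊-1 / w⌋ := by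
      have : ((⌊1 / w⌋ + 1 - ⌊-1 / w⌋).toNat : ℤ) = ⌊1 / w⌋ + 1 - ⌊-1 / w⌋ :=
        Int.toNat_of_nonneg (by omega)
      exact_mod_cast this
    rw [h4]
    have h5 : 2 / w = 1 / w - (-1 / w) := by ring
    linarith
  -- Representatives are taken only from occupied cells, so the net lies inside `F`; later its
  -- elements must themselves be far from the truth.
  let D := B.filter fun b => ∃ f ∈ F, q f = b
  have hD : ∀ b : D, ∃ f ∈ F, q f = b := fun b => (Finset.mem_filter.1 b.2).2
  choose r hrF hrq using hD
  refine ⟨Finset.univ.image r, ?_, ?_, ?_⟩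
  · intro f hf
    obtain ⟨b, -, rfl⟩ := Finset.mem_image.1 (Finset.mem_coe.1 hf)
    exact hrF b
  · refine le_trans ?_ hB
    have h1 : (Finset.univ.image r).card ≤ D.card :=
      Finset.card_image_le.trans (by simp)
    exact_mod_cast h1.trans (Finset.card_filter_le _ _)
  · intro f hf
    let b : D := ⟨q f, Finset.mem_filter.2 ⟨hq f, f, hf, rfl⟩⟩
    refine ⟨r b, Finset.mem_image_of_mem _ (Finset.mem_univ _), fun j => ?_⟩
    have h := congrFun (hrq b) j
    have h1 : |c (r b) j / w - c f j / w| < 1 := Int.abs_sub_lt_one_of_floor_eq_floor h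
    rw [← sub_div, abs_div, abs_of_pos hw, div_lt_one hw, abs_sub_comm] at h1
    exact h1.le

/-- A finite net for Gaussian mixtures in the uniform norm near finitely many centers. -/
lemma exists_finset_mixtureDensity_net {d : ℕ} (m : ℕ) {a w : ℝ} (hw : 0 < w)
    (N : Finset (EuclideanSpace ℝ (Fin d)))
    (F : Set (ProbabilityMeasure (EuclideanSpace ℝ (Fin d)))) :
    ∃ T : Finset (ProbabilityMeasure (EuclideanSpace ℝ (Fin d))), ↑T ⊆ F ∧
      (T.card : ℝ) ≤ (2 / w + 2) ^ (N.card * m ^ d) ∧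
      ∀ G ∈ F, ∃ H ∈ T, ∀ x, (∃ x₀ ∈ N, ‖x - x₀‖ ≤ a) →
        |mixtureDensity (G : Measure (EuclideanSpace ℝ (Fin d))) x -
          mixtureDensity (H : Measure (EuclideanSpace ℝ (Fin d))) x| ≤
          2 * d * Real.exp (a ^ 2 - m / 2) + m ^ d * w := by
  obtain ⟨T, hTF, hT, hF⟩ := exists_finset_forall_abs_sub_le
    (fun (G : ProbabilityMeasure (EuclideanSpace ℝ (Fin d))) (j : N × (Fin d → Fin m)) =>
      ∫ θ, gaussianProductFeature j.2 (θ - j.1) ∂(G : Measure (EuclideanSpace ℝ (Fin d))))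
    (fun G j => abs_integral_gaussianProductFeature_le_one _ _ _) hw F
  refine ⟨T, hTF, by simpa using hT, fun G hG => ?_⟩
  obtain ⟨H, hH, h⟩ := hF G hG
  refine ⟨H, hH, fun x ⟨x₀, hx₀, hx⟩ => ?_⟩
  exact abs_mixtureDensity_sub_le m hx _ _ fun κ => h (⟨x₀, hx₀⟩, κ)

/-! ### Packing and covering neighbourhoods of `S` -/

section Packing

variable {d : ℕ}

lemma volume_ball_eq (x : EuclideanSpace ℝ (Fin d)) {r : ℝ} (hr : 0 < r) :
    volume (Metric.ball x r) =
      ENNReal.ofReal (r ^ d * volume.real (Metric.ball (0 : EuclideanSpace ℝ (Fin d)) 1)) := by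
  rw [Measure.addHaar_ball_of_pos _ _ hr, finrank_euclideanSpace_fin,
    ENNReal.ofReal_mul (by positivity), ofReal_measureReal measure_ball_lt_top.ne]

lemma volume_closedBall_eq (x : EuclideanSpace ℝ (Fin d)) {r : ℝ} (hr : 0 ≤ r) :
    volume (Metric.closedBall x r) =
      ENNReal.ofReal (r ^ d * volume.real (Metric.ball (0 : EuclideanSpace ℝ (Fin d)) 1)) := by
  rw [Measure.addHaar_closedBall _ _ hr, finrank_euclideanSpace_fin,
    ENNReal.ofReal_mul (by positivity), ofReal_measureReal measure_ball_lt_top.ne]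

lemma volumeReal_unitBall_pos :
    0 < volume.real (Metric.ball (0 : EuclideanSpace ℝ (Fin d)) 1) :=
  ENNReal.toReal_pos (Metric.measure_ball_pos _ _ one_pos).ne' measure_ball_lt_top.ne

lemma isBounded_setOf_infDist_le {E : Type*} [SeminormedAddCommGroup E] {S : Set E}
    (hS : Bornology.IsBounded S) (hne : S.Nonempty) (R : ℝ) :
    Bornology.IsBounded {x | Metric.infDist x S ≤ R} := by
  obtain ⟨u, hu⟩ := hne
  obtain ⟨B, hB⟩ := hS.subset_closedBall u
  refine (Metric.isBounded_closedBall (x := u) (r := R + 1 + B)).subset fun x hx => ?_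
  obtain ⟨y, hy, hxy⟩ := (Metric.infDist_lt_iff ⟨u, hu⟩).1 (lt_of_le_of_lt hx (lt_add_one R))
  have := hB hy
  rw [Metric.mem_closedBall] at *
  linarith [dist_triangle x y u]

/-- A maximal separated set is a net whose cardinality is controlled by a volume. -/
lemma exists_net_card_mul_le {A : Set (EuclideanSpace ℝ (Fin d))} (hA : Bornology.IsBounded A)
    {r : ℝ} (hr : 0 < r) :
    ∃ N : Finset (EuclideanSpace ℝ (Fin d)), ↑N ⊆ A ∧ (∀ x ∈ A, ∃ y ∈ N, dist x y ≤ r) ∧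
      (N.card : ℝ≥0∞) * volume (Metric.ball (0 : EuclideanSpace ℝ (Fin d)) (r / 2)) ≤
        volume {x | Metric.infDist x A ≤ r / 2} := by
  have hr2 : (0 : ℝ) ≤ r / 2 := by positivity
  -- Finiteness of the packing number, from a finite cover at half the radius, makes the maximal
  -- separated set both finite and a cover.
  have hp : Metric.packingNumber r.toNNReal A ≠ ⊤ := by
    obtain ⟨N, -, hNf, hN⟩ := Metric.exists_finite_isCover_of_totallyBounded
      (ε := (r / 2).toNNReal) (by simpa using hr)
      (hA.isCompact_closure.totallyBounded.subset subset_closure)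
    have h1 := Metric.packingNumber_two_mul_le_externalCoveringNumber (r / 2).toNNReal A
    have h2 : 2 * (r / 2).toNNReal = r.toNNReal := by
      rw [← NNReal.coe_inj]
      push_cast [Real.coe_toNNReal _ hr2, Real.coe_toNNReal _ hr.le]
      ring
    rw [h2] at h1
    have h3 : Metric.externalCoveringNumber (r / 2).toNNReal A ≤ N.encard := iInf₂_le N hN
    exact ((h1.trans h3).trans_lt hNf.encard_lt_top).ne
  have hfin : (Metric.maximalSeparatedSet r.toNNReal A).Finite := by
    rw [← Set.encard_ne_top_iff, Metric.encard_maximalSeparatedSet hp]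
    exact hp
  have hsub := Metric.maximalSeparatedSet_subset (A := A) (ε := r.toNNReal)
  have hsep := Metric.isSeparated_maximalSeparatedSet (A := A) (ε := r.toNNReal)
  have hcov := Metric.isCover_maximalSeparatedSet hp
  refine ⟨hfin.toFinset, by simpa using hsub, fun x hx => ?_, ?_⟩
  · obtain ⟨y, hy, hxy⟩ := hcov hx
    refine ⟨y, by simpa using hy, ?_⟩
    have h : edist x y ≤ ENNReal.ofReal r := hxy
    rwa [edist_dist, ENNReal.ofReal_le_ofReal_iff hr.le] at h
  · have hdisj : (hfin.toFinset : Set (EuclideanSpace ℝ (Fin d))).PairwiseDisjoint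
        fun x => Metric.ball x (r / 2) := by
      intro x hx y hy hxy
      refine Metric.ball_disjoint_ball ?_
      have := hsep (by simpa using hx) (by simpa using hy) hxy
      have h : ENNReal.ofReal r < edist x y := this
      rw [edist_dist, ENNReal.ofReal_lt_ofReal_iff_of_nonneg hr.le] at h
      linarith
    calc _ = ∑ x ∈ hfin.toFinset, volume (Metric.ball x (r / 2)) := by
          simp [Measure.addHaar_ball_center]
      _ = volume (⋃ x ∈ hfin.toFinset, Metric.ball x (r / 2)) :=
          (measure_biUnion_finset hdisj fun _ _ => Metric.isOpen_ball.measurableSet).symm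
      _ ≤ _ := by
          refine measure_mono (Set.iUnion₂_subset fun x hx y hy => ?_)
          have hxA : x ∈ A := hsub (by simpa using hx)
          exact (Metric.infDist_le_dist_of_mem hxA).trans (Metric.mem_ball.1 hy).le

variable {S : Set (EuclideanSpace ℝ (Fin d))}

/-- A unit net of `S`, of cardinality at most a multiple of the volume of `S^1`. -/
lemma exists_unit_net (hS : IsCompact S) (hne : S.Nonempty) :
    ∃ N : Finset (EuclideanSpace ℝ (Fin d)),
      (∀ x, ∃ y ∈ N, dist x y ≤ Metric.infDist x S + 1) ∧
      N.card * volume.real (Metric.ball (0 : EuclideanSpace ℝ (Fin d)) 1) ≤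
        2 ^ d * volume.real {x | Metric.infDist x S ≤ 1} := by
  obtain ⟨N, -, hN, hc⟩ := exists_net_card_mul_le hS.isBounded one_pos
  refine ⟨N, fun x => ?_, ?_⟩
  · obtain ⟨u, hu, hxu⟩ := hS.exists_infDist_eq_dist hne x
    obtain ⟨y, hy, huy⟩ := hN u hu
    exact ⟨y, hy, by linarith [dist_triangle x u y]⟩
  · have hfin : volume {x | Metric.infDist x S ≤ 1} ≠ ⊤ :=
      (isBounded_setOf_infDist_le hS.isBounded hne 1).measure_lt_top.ne
    have h1 : (N.card : ℝ≥0∞) * volume (Metric.ball (0 : EuclideanSpace ℝ (Fin d)) (1 / 2)) ≤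
        volume {x | Metric.infDist x S ≤ 1} :=
      hc.trans (measure_mono fun x hx => (show Metric.infDist x S ≤ 1 / 2 from hx).trans
        (by norm_num))
    rw [volume_ball_eq _ (by norm_num)] at h1
    have h2 := ENNReal.toReal_mono hfin h1
    rw [ENNReal.toReal_mul, ENNReal.toReal_natCast,
      ENNReal.toReal_ofReal (by positivity)] at h2
    change _ ≤ volume.real {x | Metric.infDist x S ≤ 1} at h2
    calc _ = 2 ^ d * (N.card * ((1 / 2) ^ d *
          volume.real (Metric.ball (0 : EuclideanSpace ℝ (Fin d)) 1))) := by
          rw [one_div, inv_pow]; field_simp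
      _ ≤ _ := by gcongr

lemma volumeReal_unitBall_le (hS : IsCompact S) (hne : S.Nonempty) :
    volume.real (Metric.ball (0 : EuclideanSpace ℝ (Fin d)) 1) ≤
      volume.real {x | Metric.infDist x S ≤ 1} := by
  obtain ⟨u, hu⟩ := hne
  have h : Metric.ball u 1 ⊆ {x | Metric.infDist x S ≤ 1} := fun x hx =>
    (Metric.infDist_le_dist_of_mem hu).trans (Metric.mem_ball.1 hx).le
  have h1 := measureReal_mono (μ := volume) h
    (isBounded_setOf_infDist_le hS.isBounded ⟨u, hu⟩ 1).measure_lt_top.ne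
  rwa [measureReal_def, Measure.addHaar_ball_center, ← measureReal_def] at h1

lemma volume_setOf_infDist_le {N : Finset (EuclideanSpace ℝ (Fin d))}
    (hN : ∀ x, ∃ y ∈ N, dist x y ≤ Metric.infDist x S + 1) {R : ℝ} (hR : 0 ≤ R) :
    volume {x | Metric.infDist x S ≤ R} ≤ ENNReal.ofReal (N.card * ((R + 1) ^ d *
      volume.real (Metric.ball (0 : EuclideanSpace ℝ (Fin d)) 1))) := by
  have h : {x | Metric.infDist x S ≤ R} ⊆ ⋃ y ∈ N, Metric.closedBall y (R + 1) := by
    intro x hx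
    obtain ⟨y, hy, hxy⟩ := hN x
    exact Set.mem_iUnion₂.2 ⟨y, hy, hxy.trans (add_le_add_left hx 1)⟩
  refine (measure_mono h).trans ((measure_biUnion_finset_le _ _).trans ?_)
  simp_rw [fun y : EuclideanSpace ℝ (Fin d) =>
    volume_closedBall_eq y (show (0 : ℝ) ≤ R + 1 by positivity)]
  rw [Finset.sum_const, nsmul_eq_mul, ← ENNReal.ofReal_natCast,
    ← ENNReal.ofReal_mul (by positivity)]

/-- A net of the `M`-neighbourhood of `S`. -/
lemma exists_net_thickening (hS : IsCompact S) (hne : S.Nonempty) {M a : ℝ} (ha : 0 < a)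
    (haM : a / 2 + 1 ≤ M) :
    ∃ N : Finset (EuclideanSpace ℝ (Fin d)),
      (∀ x, Metric.infDist x S ≤ M → ∃ y ∈ N, ‖x - y‖ ≤ a) ∧
      N.card * volume.real (Metric.ball (0 : EuclideanSpace ℝ (Fin d)) 1) ≤
        (8 * M / a) ^ d * volume.real {x | Metric.infDist x S ≤ 1} := by
  obtain ⟨N₁, hN₁, hc₁⟩ := exists_unit_net hS hne
  obtain ⟨N, -, hN, hc⟩ := exists_net_card_mul_le
    (isBounded_setOf_infDist_le hS.isBounded hne M) ha
  have hM : 0 < M := by linarith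
  refine ⟨N, fun x hx => ?_, ?_⟩
  · simpa only [dist_eq_norm] using hN x hx
  have hne' : {x | Metric.infDist x S ≤ M}.Nonempty :=
    hne.mono fun x hx => by simp [Metric.infDist_zero_of_mem hx, hM.le]
  have hsub : {x | Metric.infDist x {y | Metric.infDist y S ≤ M} ≤ a / 2} ⊆
      {x | Metric.infDist x S ≤ M + a / 2} := by
    intro x hx
    change Metric.infDist x S ≤ M + a / 2
    refine le_of_forall_pos_le_add fun δ hδ => ?_
    obtain ⟨y, hy, hxy⟩ := (Metric.infDist_lt_iff hne').1
      (lt_of_le_of_lt (show Metric.infDist x _ ≤ a / 2 from hx)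
        (show a / 2 < a / 2 + δ by linarith))
    have h1 : Metric.infDist y S ≤ M := hy
    linarith [Metric.infDist_le_infDist_add_dist (s := S) (x := x) (y := y)]
  have h := hc.trans ((measure_mono hsub).trans (volume_setOf_infDist_le hN₁ (by positivity)))
  rw [volume_ball_eq _ (by positivity), ← ENNReal.ofReal_natCast,
    ← ENNReal.ofReal_mul (by positivity), ENNReal.ofReal_le_ofReal_iff (by positivity)] at h
  set ω := volume.real (Metric.ball (0 : EuclideanSpace ℝ (Fin d)) 1)
  have hω : 0 ≤ ω := measureReal_nonneg
  calc N.card * ω = (2 / a) ^ d * (N.card * ((a / 2) ^ d * ω)) := by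
        have : (2 / a) ^ d * (a / 2) ^ d = 1 := by
          rw [← mul_pow, show 2 / a * (a / 2) = 1 by field_simp, one_pow]
        linear_combination (-(N.card : ℝ) * ω) * this
    _ ≤ (2 / a) ^ d * (N₁.card * ((M + a / 2 + 1) ^ d * ω)) := by gcongr
    -- The hypothesis `haM` gives `M + a / 2 + 1 ≤ 2 * M`.
    _ ≤ (2 / a) ^ d * (N₁.card * ((2 * M) ^ d * ω)) := by gcongr; linarith
    _ = (4 * M / a) ^ d * (N₁.card * ω) := by
        rw [show 4 * M / a = 2 / a * (2 * M) by ring, mul_pow _ (2 * M)]; ring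
    _ ≤ (4 * M / a) ^ d * (2 ^ d * volume.real {x | Metric.infDist x S ≤ 1}) := by gcongr
    _ = _ := by rw [show 8 * M / a = 4 * M / a * 2 by ring, mul_pow]; ring

end Packing

/-! ### An integrable envelope away from `S` -/

section TailWeight

noncomputable section

/-- The weight that is `1` on the `M`-neighbourhood of `S` and decays polynomially outside. -/
def tailWeight {d : ℕ} (M : ℝ) (S : Set (EuclideanSpace ℝ (Fin d)))
    (x : EuclideanSpace ℝ (Fin d)) : ℝ :=
  if Metric.infDist x S ≤ M then 1 else (M / Metric.infDist x S) ^ (d + 1)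

end

variable {d : ℕ} {S : Set (EuclideanSpace ℝ (Fin d))} {M : ℝ}

lemma tailWeight_pos (hM : 0 < M) (x : EuclideanSpace ℝ (Fin d)) : 0 < tailWeight M S x := by
  unfold tailWeight
  split_ifs with h
  · exact one_pos
  · have : 0 < Metric.infDist x S := hM.trans (not_le.1 h)
    positivity

lemma measurable_tailWeight : Measurable (tailWeight M S) := by
  unfold tailWeight
  refine Measurable.ite (measurableSet_le (Metric.continuous_infDist_pt S).measurable
    measurable_const) measurable_const ?_
  exact (measurable_const.div (Metric.continuous_infDist_pt S).measurable).pow_const _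

/-- Dominates the weight at `x` by a bump of width `2 * M` around a nearby net point `y`. The power
`d + 1` is integrable at infinity on `ℝ^d`. -/
lemma tailWeight_le (hM : 1 ≤ M) {x y : EuclideanSpace ℝ (Fin d)}
    (hxy : dist x y ≤ Metric.infDist x S + 1) :
    tailWeight M S x ≤ 2 ^ (d + 1) * (1 + ‖(2 * M)⁻¹ • (x - y)‖) ^ (-((d : ℝ) + 1)) := by
  have hM0 : 0 < M := by linarith
  rw [norm_smul, norm_inv, Real.norm_of_nonneg (by positivity), ← dist_eq_norm,
    Real.rpow_neg (by positivity), show ((d : ℝ) + 1) = ((d + 1 : ℕ) : ℝ) by push_cast; ring,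
    Real.rpow_natCast, ← div_eq_mul_inv, ← div_pow]
  unfold tailWeight
  have hd : 0 ≤ dist x y := dist_nonneg
  split_ifs with h
  · refine one_le_pow₀ ((one_le_div (by positivity)).2 ?_)
    have : (2 * M)⁻¹ * dist x y ≤ 1 := by
      rw [inv_mul_le_one₀ (by positivity)]; linarith
    linarith
  · rw [not_le] at h
    have h0 : 0 < Metric.infDist x S := hM0.trans h
    refine pow_le_pow_left₀ (by positivity) ?_ _
    rw [div_le_div_iff₀ h0 (by positivity)]
    have : M * ((2 * M)⁻¹ * dist x y) = dist x y / 2 := by field_simp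
    linarith

/-- Sum the bumps over a unit net of `S`: the net has size at most a multiple of the volume of
`S^1`, and rescaling each bump gives `(2 * M) ^ d`. -/
lemma exists_lintegral_tailWeight_le (d : ℕ) :
    ∃ C : ℝ, 0 < C ∧ ∀ (S : Set (EuclideanSpace ℝ (Fin d))), IsCompact S → S.Nonempty →
      ∀ M : ℝ, 1 ≤ M → ∫⁻ x, ENNReal.ofReal (tailWeight M S x) ≤
        ENNReal.ofReal (C * (volume.real {x | Metric.infDist x S ≤ 1} * M ^ d)) := by
  set ω := volume.real (Metric.ball (0 : EuclideanSpace ℝ (Fin d)) 1) with hωdef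
  have hω : 0 < ω := volumeReal_unitBall_pos
  set f : EuclideanSpace ℝ (Fin d) → ℝ := fun x => (1 + ‖x‖) ^ (-((d : ℝ) + 1)) with hf
  have hfm : Measurable f := by fun_prop
  have hfi : Integrable f := integrable_one_add_norm (by simp)
  have hf0 : ∀ x, 0 ≤ f x := fun x => by positivity
  set κ := ∫ x, f x with hκ
  have hκ0 : 0 ≤ κ := integral_nonneg hf0
  have hfκ : ∫⁻ x, ENNReal.ofReal (f x) = ENNReal.ofReal κ :=
    (ofReal_integral_eq_lintegral_ofReal hfi (ae_of_all _ hf0)).symm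
  -- Using `κ + 1` makes the constant visibly positive.
  refine ⟨2 ^ (d + 1) * 2 ^ d * 2 ^ d / ω * (κ + 1), by positivity, fun S hS hne M hM => ?_⟩
  have hM0 : 0 < M := by linarith
  obtain ⟨N, hN, hc⟩ := exists_unit_net hS hne
  have hscale : ∀ y : EuclideanSpace ℝ (Fin d),
      ∫⁻ x, ENNReal.ofReal (2 ^ (d + 1) * f ((2 * M)⁻¹ • (x - y))) =
        ENNReal.ofReal (2 ^ (d + 1) * ((2 * M) ^ d * κ)) := by
    intro y
    rw [lintegral_sub_right_eq_self
      (fun x => ENNReal.ofReal (2 ^ (d + 1) * f ((2 * M)⁻¹ • x))) y]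
    simp_rw [ENNReal.ofReal_mul (show (0 : ℝ) ≤ 2 ^ (d + 1) by positivity)]
    rw [lintegral_const_mul _ (by fun_prop)]
    congr 1
    have := lintegral_map (μ := (volume : Measure (EuclideanSpace ℝ (Fin d))))
      hfm.ennreal_ofReal (measurable_const_smul ((2 * M)⁻¹))
    rw [← this, Measure.map_addHaar_smul _ (by positivity), lintegral_smul_measure, hfκ,
      finrank_euclideanSpace_fin, inv_pow, inv_inv, abs_of_nonneg (by positivity), smul_eq_mul,
      ← ENNReal.ofReal_mul (by positivity)]
  calc ∫⁻ x, ENNReal.ofReal (tailWeight M S x)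
      ≤ ∫⁻ x, ∑ y ∈ N, ENNReal.ofReal (2 ^ (d + 1) * f ((2 * M)⁻¹ • (x - y))) := by
        refine lintegral_mono fun x => ?_
        obtain ⟨y, hy, hxy⟩ := hN x
        exact (ENNReal.ofReal_le_ofReal (tailWeight_le hM hxy)).trans
          (Finset.single_le_sum
            (f := fun y => ENNReal.ofReal (2 ^ (d + 1) * f ((2 * M)⁻¹ • (x - y))))
            (fun _ _ => zero_le) hy)
    _ = ENNReal.ofReal (N.card * (2 ^ (d + 1) * ((2 * M) ^ d * κ))) := by
        rw [lintegral_finsetSum _ fun y _ => by fun_prop]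
        simp_rw [hscale]
        rw [Finset.sum_const, nsmul_eq_mul, ← ENNReal.ofReal_natCast,
          ← ENNReal.ofReal_mul (by positivity)]
    _ ≤ _ := by
        refine ENNReal.ofReal_le_ofReal ?_
        have hc' : (N.card : ℝ) ≤ 2 ^ d * volume.real {x | Metric.infDist x S ≤ 1} / ω := by
          rwa [le_div_iff₀ hω]
        calc _ ≤ 2 ^ d * volume.real {x | Metric.infDist x S ≤ 1} / ω *
              (2 ^ (d + 1) * ((2 * M) ^ d * (κ + 1))) := by
              gcongr; linarith
          _ = _ := by rw [mul_pow]; ring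

end TailWeight

/-! ### Markov's inequality for products -/

section ProductMarkov

/-- From `a ≤ exp (a - 1)`. It converts a product of means over different laws into their sum, which
depends only on the average law. -/
lemma prod_le_ofReal_exp {ι : Type*} [Fintype ι] (a : ι → ℝ≥0∞) {T : ℝ} (hT : 0 ≤ T)
    (h : ∑ i, a i ≤ ENNReal.ofReal T) :
    ∏ i, a i ≤ ENNReal.ofReal (Real.exp (T - Fintype.card ι)) := by
  have hfin : ∀ i, a i ≠ ⊤ := fun i =>
    ((Finset.single_le_sum (f := a) (fun _ _ => zero_le) (Finset.mem_univ i)).trans_lt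
      (h.trans_lt ENNReal.ofReal_lt_top)).ne
  have hs : ∑ i, (a i).toReal ≤ T := by
    rw [← ENNReal.toReal_sum fun i _ => hfin i]
    exact ENNReal.toReal_le_of_le_ofReal hT h
  have hp : ∏ i, a i = ENNReal.ofReal (∏ i, (a i).toReal) := by
    rw [ENNReal.ofReal_prod_of_nonneg fun _ _ => ENNReal.toReal_nonneg]
    exact Finset.prod_congr rfl fun i _ => (ENNReal.ofReal_toReal (hfin i)).symm
  rw [hp]
  refine ENNReal.ofReal_le_ofReal ?_
  calc ∏ i, (a i).toReal ≤ ∏ i, Real.exp ((a i).toReal - 1) :=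
        Finset.prod_le_prod (fun _ _ => ENNReal.toReal_nonneg) fun i _ => by
          linarith [Real.add_one_le_exp ((a i).toReal - 1)]
    _ = Real.exp (∑ i, (a i).toReal - Fintype.card ι) := by
        rw [← Real.exp_sum, Finset.sum_sub_distrib]; simp
    _ ≤ _ := by gcongr

/-- Markov's inequality for a product of functions of independent random variables. -/
lemma measure_ofReal_exp_le_prod_le {ι Ω E : Type*} [Fintype ι] [MeasurableSpace Ω]
    [MeasurableSpace E] {P : Measure Ω} [IsProbabilityMeasure P] {μ : ι → Measure E}
    {X : ι → Ω → E} (hX : ∀ i, HasLaw (X i) (μ i) P) (hI : iIndepFun X P) {g : E → ℝ≥0∞}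
    (hg : Measurable g) {T : ℝ} (hT : 0 ≤ T) (h : ∑ i, ∫⁻ x, g x ∂(μ i) ≤ ENNReal.ofReal T)
    (c : ℝ) :
    P {ω | ENNReal.ofReal (Real.exp c) ≤ ∏ i, g (X i ω)} ≤
      ENNReal.ofReal (Real.exp (T - Fintype.card ι - c)) := by
  have hX' : ∀ i, AEMeasurable (X i) P := fun i => (hX i).aemeasurable
  -- The `X i` are only almost everywhere measurable, so the product formula is applied to
  -- measurable modifications.
  have hI' : iIndepFun (fun i => (hX' i).mk) P := hI.congr fun i => (hX' i).ae_eq_mk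
  have hE : ∫⁻ ω, ∏ i, g (X i ω) ∂P ≤ ENNReal.ofReal (Real.exp (T - Fintype.card ι)) := by
    have h1 : ∫⁻ ω, ∏ i, g (X i ω) ∂P = ∫⁻ ω, ∏ i, g ((hX' i).mk (X i) ω) ∂P := by
      refine lintegral_congr_ae ?_
      filter_upwards [ae_all_iff.2 fun i => (hX' i).ae_eq_mk] with ω hω
      simp_rw [hω]
    rw [h1, lintegral_prod_eq_prod_lintegral_of_indepFun Finset.univ
      (fun i ω => g ((hX' i).mk (X i) ω)) (hI'.comp (fun _ => g) fun _ => hg)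
      fun i => hg.comp (hX' i).measurable_mk]
    have h2 : ∀ i, ∫⁻ ω, g ((hX' i).mk (X i) ω) ∂P = ∫⁻ x, g x ∂(μ i) := by
      intro i
      rw [← (hX i).lintegral_comp hg.aemeasurable]
      refine lintegral_congr_ae ?_
      filter_upwards [(hX' i).ae_eq_mk] with ω hω
      rw [hω]
    simp_rw [h2]
    exact prod_le_ofReal_exp _ hT h
  have hm : AEMeasurable (fun ω => ∏ i, g (X i ω)) P :=
    Finset.aemeasurable_fun_prod _ fun i _ => hg.comp_aemeasurable (hX' i)
  refine (meas_ge_le_lintegral_div hm (by simp [Real.exp_pos]) ENNReal.ofReal_ne_top).trans ?_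
  refine (ENNReal.div_le_div_right hE _).trans ?_
  rw [← ENNReal.ofReal_div_of_pos (Real.exp_pos _), ← Real.exp_sub]

end ProductMarkov

/-! ### Likelihood ratios of competitors far from the truth -/

section LikelihoodRatio

variable {d n : ℕ}

lemma ofReal_mul_ofReal_sqrt_div {p q : ℝ} (hp : 0 < p) (hq : 0 ≤ q) :
    ENNReal.ofReal p * ENNReal.ofReal √(q / p) = ENNReal.ofReal (√q * √p) := by
  rw [← ENNReal.ofReal_mul hp.le]
  congr 1
  rw [Real.sqrt_div hq]
  have h : √p ≠ 0 := (Real.sqrt_pos.2 hp).ne'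
  field_simp
  rw [Real.sq_sqrt hp.le, mul_comm]

/-- Subadditivity of the square root and a weighted AM–GM inequality. With `c = n` and `∫ h ≤ B /
n²`, the perturbation costs `(B + 1) / (2 n)` per observation, hence `(B + 1) / 2` over the sample.
-/
lemma sqrt_add_mul_sqrt_le {f h g c : ℝ} (hf : 0 ≤ f) (hh : 0 ≤ h) (hg : 0 ≤ g) (hc : 0 < c) :
    √(f + h) * √g ≤ √f * √g + (c * h + c⁻¹ * g) / 2 := by
  have h1 : √(f + h) ≤ √f + √h := by
    rw [Real.sqrt_le_left (by positivity)]
    nlinarith [Real.sq_sqrt hf, Real.sq_sqrt hh, Real.sqrt_nonneg f, Real.sqrt_nonneg h,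
      mul_nonneg (Real.sqrt_nonneg f) (Real.sqrt_nonneg h)]
  have h2 : √h * √g ≤ (c * h + c⁻¹ * g) / 2 := by
    have e : c * h + c⁻¹ * g - 2 * (√h * √g) = c⁻¹ * (c * √h - √g) ^ 2 := by
      have := Real.sq_sqrt hh
      have := Real.sq_sqrt hg
      field_simp
      nlinarith
    have : 0 ≤ c⁻¹ * (c * √h - √g) ^ 2 := by positivity
    linarith
  nlinarith [Real.sqrt_nonneg g]

/-- The likelihood ratio of a perturbed competitor far from the truth is exponentially small. -/
lemma measure_exp_le_prod_sqrt_ratio_le {Ω : Type*} [MeasurableSpace Ω] {P : Measure Ω}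
    [IsProbabilityMeasure P] (hn : n ≠ 0) {G : Fin n → Measure (EuclideanSpace ℝ (Fin d))}
    (hG : ∀ i, IsProbabilityMeasure (G i)) {X : Fin n → Ω → EuclideanSpace ℝ (Fin d)}
    (hX : ∀ i, HasLaw (X i) (mixtureLaw (G i)) P) (hI : iIndepFun X P)
    (H : Measure (EuclideanSpace ℝ (Fin d))) [IsProbabilityMeasure H]
    {h : EuclideanSpace ℝ (Fin d) → ℝ} (hh : ∀ x, 0 ≤ h x) (hhm : Measurable h) {B R : ℝ}
    (hB : 0 ≤ B) (hhB : ∫⁻ x, ENNReal.ofReal (h x) ≤ ENNReal.ofReal (B / n ^ 2))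
    (hR : ENNReal.ofReal R ≤
      hellingerSq (mixtureDensity H) (mixtureDensity (averageMeasure G))) (c : ℝ) :
    P {ω | ENNReal.ofReal (Real.exp c) ≤ ∏ i, ENNReal.ofReal
        √((mixtureDensity H (X i ω) + h (X i ω)) / mixtureDensity (averageMeasure G) (X i ω))} ≤
      ENNReal.ofReal (Real.exp (-(n * R / 2) + (B + 1) / 2 - c)) := by
  have := isProbabilityMeasure_averageMeasure G hn hG
  have hn0 : (0 : ℝ) < n := by positivity
  set f := mixtureDensity H with hf
  set g := mixtureDensity (averageMeasure G) with hg
  have hf0 : ∀ x, 0 ≤ f x := mixtureDensity_nonneg H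
  have hg0 : ∀ x, 0 < g x := mixtureDensity_pos _
  have hfm : Measurable f := (continuous_mixtureDensity H).measurable
  have hgm : Measurable g := (continuous_mixtureDensity _).measurable
  set A := ∫⁻ x, ENNReal.ofReal (√(f x) * √(g x)) with hA
  have hadd : hellingerSq f g + 2 * A = 2 := hellingerSq_add_affinity hf0 (fun x => (hg0 x).le)
    hfm hgm (lintegral_mixtureDensity H) (lintegral_mixtureDensity _)
  have hA1 : A ≠ ⊤ := by
    intro h; rw [h] at hadd; simp at hadd
  have hH1 : hellingerSq f g ≠ ⊤ := by
    intro h; rw [h] at hadd; simp at hadd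
  have hAR : A.toReal ≤ 1 - R / 2 := by
    have h1 := congrArg ENNReal.toReal hadd
    rw [ENNReal.toReal_add hH1 (by finiteness), ENNReal.toReal_mul, ENNReal.toReal_ofNat] at h1
    have h2 := (ENNReal.ofReal_le_iff_le_toReal hH1).1 hR
    linarith
  have hm : Measurable fun x => ENNReal.ofReal √((f x + h x) / g x) := by fun_prop
  have hint : ∫⁻ x, ENNReal.ofReal √((f x + h x) / g x) ∂(mixtureLaw (averageMeasure G)) ≤
      ENNReal.ofReal (A.toReal + (n * (B / n ^ 2) + (n : ℝ)⁻¹ * 1) / 2) := by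
    rw [lintegral_mixtureLaw _ hm]
    calc _ = ∫⁻ x, ENNReal.ofReal (√(f x + h x) * √(g x)) := lintegral_congr fun x =>
          ofReal_mul_ofReal_sqrt_div (hg0 x) (add_nonneg (hf0 x) (hh x))
      _ ≤ ∫⁻ x, (ENNReal.ofReal (√(f x) * √(g x)) + (ENNReal.ofReal (n / 2) *
            ENNReal.ofReal (h x) + ENNReal.ofReal ((n : ℝ)⁻¹ / 2) * ENNReal.ofReal (g x))) := by
          refine lintegral_mono fun x => ?_
          have h1 := hh x
          have h2 := (hg0 x).le
          rw [← ENNReal.ofReal_mul (by positivity), ← ENNReal.ofReal_mul (by positivity),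
            ← ENNReal.ofReal_add (by positivity) (by positivity),
            ← ENNReal.ofReal_add (by positivity) (by positivity)]
          refine ENNReal.ofReal_le_ofReal
            ((sqrt_add_mul_sqrt_le (hf0 x) h1 h2 hn0).trans_eq (by ring))
      _ = A + (ENNReal.ofReal (n / 2) * (∫⁻ x, ENNReal.ofReal (h x)) +
            ENNReal.ofReal ((n : ℝ)⁻¹ / 2) * 1) := by
          rw [lintegral_add_left (by fun_prop), lintegral_add_left (by fun_prop),
            lintegral_const_mul _ (by fun_prop), lintegral_const_mul _ (by fun_prop),
            lintegral_mixtureDensity]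
      _ ≤ A + (ENNReal.ofReal (n / 2) * ENNReal.ofReal (B / n ^ 2) +
            ENNReal.ofReal ((n : ℝ)⁻¹ / 2) * 1) := by gcongr
      _ = _ := by
          rw [mul_one, ← ENNReal.ofReal_mul (by positivity),
            ← ENNReal.ofReal_add (by positivity) (by positivity)]
          nth_rewrite 1 [← ENNReal.ofReal_toReal hA1]
          rw [← ENNReal.ofReal_add (by positivity) (by positivity)]
          congr 1; ring
  have hsum : ∑ i, ∫⁻ x, ENNReal.ofReal √((f x + h x) / g x) ∂(mixtureLaw (G i)) ≤
      ENNReal.ofReal (n * (A.toReal + (n * (B / n ^ 2) + (n : ℝ)⁻¹ * 1) / 2)) := by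
    rw [sum_lintegral_mixtureLaw G hn hG hm, ENNReal.ofReal_mul (by positivity),
      ENNReal.ofReal_natCast]
    gcongr
  refine (measure_ofReal_exp_le_prod_le hX hI hm (by positivity) hsum c).trans
    (ENNReal.ofReal_le_ofReal (Real.exp_le_exp.2 ?_))
  have e : n * (A.toReal + (n * (B / n ^ 2) + (n : ℝ)⁻¹ * 1) / 2) =
      n * A.toReal + (B + 1) / 2 := by field_simp
  rw [e, Fintype.card_fin]
  nlinarith

end LikelihoodRatio

/-! ### Gaussian tail beyond `M / 2` -/

section GaussianTail

lemma half_le_log_natCast {n : ℕ} (hn : 2 ≤ n) : 1 / 2 < Real.log n := by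
  have : Real.log 2 ≤ Real.log n := Real.log_le_log (by norm_num) (by exact_mod_cast hn)
  linarith [Real.log_two_gt_d9]

lemma two_le_of_sqrt_le {n : ℕ} (hn : 2 ≤ n) {M : ℝ} (hM : √(10 * Real.log n) ≤ M) : 2 ≤ M := by
  refine le_trans ?_ hM
  rw [Real.le_sqrt (by norm_num) (by linarith [half_le_log_natCast hn])]
  linarith [half_le_log_natCast hn]

lemma pow_le_factorial_mul_exp_sq (k : ℕ) {r : ℝ} (hr : 0 ≤ r) :
    r ^ k ≤ k ! * Real.exp 5 * Real.exp (r ^ 2 / 20) := by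
  have h := Real.pow_div_factorial_le_exp r hr k
  rw [div_le_iff₀ (by positivity)] at h
  have h2 : Real.exp r ≤ Real.exp 5 * Real.exp (r ^ 2 / 20) := by
    rw [← Real.exp_add, Real.exp_le_exp]
    nlinarith [sq_nonneg (r - 10)]
  calc r ^ k ≤ Real.exp r * k ! := h
    _ ≤ Real.exp 5 * Real.exp (r ^ 2 / 20) * k ! := by gcongr
    _ = _ := by ring

/-- A truncated moment of the Gaussian law. -/
lemma exists_lintegral_gaussian_tail_le (d : ℕ) :
    ∃ C : ℝ, 0 < C ∧ ∀ n : ℕ, 2 ≤ n → ∀ M : ℝ, √(10 * Real.log n) ≤ M →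
      ∫⁻ z, ENNReal.ofReal (stdGaussianDensity d z) *
        ENNReal.ofReal (if M / 2 ≤ ‖z‖ then (2 * ‖z‖ / M) ^ (((d : ℝ) + 1) / (2 * Real.log n))
          else 0) ≤ ENNReal.ofReal (C / n) := by
  set f : EuclideanSpace ℝ (Fin d) → ℝ := fun z => Real.exp (-(1 / 20) * ‖z‖ ^ 2) with hf
  have hfint := GaussianFourier.integral_rexp_neg_mul_sq_norm
    (V := EuclideanSpace ℝ (Fin d)) (b := 1 / 20) (by norm_num)
  set κ := ∫ z, f z with hκ
  have hκ0 : 0 < κ := by rw [hfint]; positivity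
  have hfi : Integrable f := by
    by_contra h
    exact hκ0.ne' (integral_undef h)
  have hfκ : ∫⁻ z, ENNReal.ofReal (f z) = ENNReal.ofReal κ :=
    (ofReal_integral_eq_lintegral_ofReal hfi (ae_of_all _ fun z => (Real.exp_pos _).le)).symm
  refine ⟨(d + 1)! * Real.exp 5 * κ, by positivity, fun n hn M hM => ?_⟩
  have hL := half_le_log_natCast hn
  have hM2 := two_le_of_sqrt_le hn hM
  have hM0 : 0 < M := by linarith
  have hn0 : (0 : ℝ) < n := by positivity
  -- The source of the condition `M ≥ √(10 log n)`.
  have hMn : Real.exp (-(M ^ 2 / 10)) ≤ 1 / n := by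
    rw [one_div, ← Real.exp_log (inv_pos.2 hn0), Real.log_inv, Real.exp_le_exp]
    have := (Real.sqrt_le_left hM0.le).1 hM
    linarith
  have hpt : ∀ z : EuclideanSpace ℝ (Fin d), ENNReal.ofReal (stdGaussianDensity d z) *
      ENNReal.ofReal (if M / 2 ≤ ‖z‖ then (2 * ‖z‖ / M) ^ (((d : ℝ) + 1) / (2 * Real.log n))
        else 0) ≤ ENNReal.ofReal ((d + 1)! * Real.exp 5 / n) * ENNReal.ofReal (f z) := by
    intro z
    rw [← ENNReal.ofReal_mul (stdGaussianDensity_pos z).le, ← ENNReal.ofReal_mul (by positivity)]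
    refine ENNReal.ofReal_le_ofReal ?_
    split_ifs with hz
    · have h1 : 1 ≤ 2 * ‖z‖ / M := by rw [one_le_div hM0]; linarith
      -- The exponent is at most `d + 1` because `2 * log n > 1`, and `2 / M ≤ 1`.
      have h2 : (2 * ‖z‖ / M) ^ (((d : ℝ) + 1) / (2 * Real.log n)) ≤ ‖z‖ ^ (d + 1) := by
        calc _ ≤ (2 * ‖z‖ / M) ^ (((d + 1 : ℕ) : ℝ)) := by
              refine Real.rpow_le_rpow_of_exponent_le h1 ?_
              push_cast
              exact div_le_self (by positivity) (by linarith)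
          _ = (2 * ‖z‖ / M) ^ (d + 1) := Real.rpow_natCast _ _
          _ ≤ _ := by
              refine pow_le_pow_left₀ (by positivity) ?_ _
              rw [div_le_iff₀ hM0]
              nlinarith [norm_nonneg z]
      have h3 : stdGaussianDensity d z ≤ Real.exp (-‖z‖ ^ 2 / 2) :=
        mul_le_of_le_one_left (Real.exp_pos _).le (two_pi_rpow_le_one d)
      have h4 := pow_le_factorial_mul_exp_sq (d + 1) (norm_nonneg z)
      -- As `‖z‖ ≥ M / 2`, four fifths of the exponent pay for `M ^ 2 / 10`. Half of the remaining
      -- `‖z‖ ^ 2 / 10` absorbs the polynomial and the other half is integrated.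
      have h5 : Real.exp (-‖z‖ ^ 2 / 2) ≤
          Real.exp (-(M ^ 2 / 10)) * Real.exp (-(‖z‖ ^ 2 / 10)) := by
        rw [← Real.exp_add, Real.exp_le_exp]
        nlinarith
      calc _ ≤ (1 / n * Real.exp (-(‖z‖ ^ 2 / 10))) *
            ((d + 1)! * Real.exp 5 * Real.exp (‖z‖ ^ 2 / 20)) := by
            refine mul_le_mul (h3.trans (h5.trans (by gcongr))) (h2.trans h4) (by positivity)
              (by positivity)
        _ = (d + 1)! * Real.exp 5 / n *
            (Real.exp (-(‖z‖ ^ 2 / 10)) * Real.exp (‖z‖ ^ 2 / 20)) := by ring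
        _ = _ := by
            rw [← Real.exp_add]
            congr 2; ring
    · rw [mul_zero]; positivity
  calc _ ≤ ∫⁻ z, ENNReal.ofReal ((d + 1)! * Real.exp 5 / n) * ENNReal.ofReal (f z) :=
        lintegral_mono hpt
    _ = _ := by
        rw [lintegral_const_mul _ (by fun_prop), hfκ, ← ENNReal.ofReal_mul (by positivity)]
        congr 1; ring

end GaussianTail

/-! ### Observations far from `S` -/

section OutlierWeight

noncomputable section

/-- The reciprocal of `tailWeight M S / n ^ 2` outside the `M`-neighbourhood of `S`. -/
def outlierWeight {d : ℕ} (n : ℕ) (M : ℝ) (S : Set (EuclideanSpace ℝ (Fin d)))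
    (x : EuclideanSpace ℝ (Fin d)) : ℝ :=
  if Metric.infDist x S ≤ M then 1 else (n : ℝ) ^ 2 * (Metric.infDist x S / M) ^ (d + 1)

end

variable {d n : ℕ} {S : Set (EuclideanSpace ℝ (Fin d))} {M : ℝ}

lemma outlierWeight_pos (hn : n ≠ 0) (hM : 0 < M) (x : EuclideanSpace ℝ (Fin d)) :
    0 < outlierWeight n M S x := by
  unfold outlierWeight
  split_ifs with h
  · exact one_pos
  · have : 0 < Metric.infDist x S := hM.trans (not_le.1 h)
    have : (0 : ℝ) < n := by positivity
    positivity

lemma measurable_outlierWeight : Measurable (outlierWeight n M S) := by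
  unfold outlierWeight
  refine Measurable.ite (measurableSet_le (Metric.continuous_infDist_pt S).measurable
    measurable_const) measurable_const ?_
  exact (((Metric.continuous_infDist_pt S).measurable.div_const _).pow_const _).const_mul _

/-- Passing from a density to a nearby one, up to a perturbation and an outlier weight. -/
lemma le_add_tailWeight_mul_outlierWeight (hn : n ≠ 0) (hM : 0 < M) {f g : ℝ} (hf1 : f ≤ 1)
    (hg0 : 0 ≤ g) {x : EuclideanSpace ℝ (Fin d)}
    (hfg : Metric.infDist x S ≤ M → |f - g| ≤ 1 / (n : ℝ) ^ 2) :
    f ≤ (g + 1 / (n : ℝ) ^ 2 * tailWeight M S x) * outlierWeight n M S x := by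
  unfold tailWeight outlierWeight
  have hn0 : (0 : ℝ) < n := by positivity
  split_ifs with h
  · linarith [(abs_le.1 (hfg h)).2]
  · have h0 : 0 < Metric.infDist x S := hM.trans (not_le.1 h)
    have e : 1 / (n : ℝ) ^ 2 * (M / Metric.infDist x S) ^ (d + 1) *
        ((n : ℝ) ^ 2 * (Metric.infDist x S / M) ^ (d + 1)) = 1 := by
      have : (M / Metric.infDist x S) ^ (d + 1) * (Metric.infDist x S / M) ^ (d + 1) = 1 := by
        rw [← mul_pow, div_mul_div_comm, mul_comm M, div_self (by positivity), one_pow]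
      field_simp at this ⊢
      linear_combination this
    rw [add_mul, e]
    have : 0 ≤ g * ((n : ℝ) ^ 2 * (Metric.infDist x S / M) ^ (d + 1)) := by positivity
    linarith

/-- The power is chosen so that `(n²)^(1 / (2 log n)) = e`. If `θ + z` is at distance `D > M` from
`S`, then either `θ` is at distance at least `D / 2`, or `‖z‖ > D / 2`. In the first case `D / M ≥
1` allows any larger exponent `p`; the second keeps the smallest exponent, so the Gaussian term does
not depend on `p`. -/
lemma outlierWeight_rpow_le (hn : 2 ≤ n) (hM : 0 < M) {p : ℝ}
    (hp : ((d : ℝ) + 1) / (2 * Real.log n) ≤ p) (θ z : EuclideanSpace ℝ (Fin d)) :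
    outlierWeight n M S (θ + z) ^ (1 / (2 * Real.log n)) ≤
      1 + Real.exp 1 * ((2 * Metric.infDist θ S / M) ^ p +
        if M / 2 ≤ ‖z‖ then (2 * ‖z‖ / M) ^ (((d : ℝ) + 1) / (2 * Real.log n)) else 0) := by
  have hL := half_le_log_natCast hn
  have hn0 : (0 : ℝ) < n := by positivity
  set p₀ := ((d : ℝ) + 1) / (2 * Real.log n) with hp₀
  have hp₀0 : 0 ≤ p₀ := by positivity
  have hB : 0 ≤ if M / 2 ≤ ‖z‖ then (2 * ‖z‖ / M) ^ p₀ else 0 := by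
    split_ifs <;> positivity
  have hθ0 : 0 ≤ Metric.infDist θ S := Metric.infDist_nonneg
  have hA : 0 ≤ (2 * Metric.infDist θ S / M) ^ p := by positivity
  unfold outlierWeight
  by_cases h : Metric.infDist (θ + z) S ≤ M
  · rw [if_pos h, Real.one_rpow]
    have := mul_nonneg (Real.exp_pos 1).le (add_nonneg hA hB)
    linarith
  rw [if_neg h]
  rw [not_le] at h
  set D := Metric.infDist (θ + z) S with hD
  have hD0 : 0 < D := hM.trans h
  have hDM : 1 ≤ D / M := (one_le_div hM).2 h.le
  have hDle : D ≤ Metric.infDist θ S + ‖z‖ := by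
    have := Metric.infDist_le_infDist_add_dist (s := S) (x := θ + z) (y := θ)
    simpa [dist_eq_norm] using this
  have e1 : ((n : ℝ) ^ 2 * (D / M) ^ (d + 1)) ^ (1 / (2 * Real.log n)) =
      Real.exp 1 * (D / M) ^ p₀ := by
    rw [Real.mul_rpow (by positivity) (by positivity), ← Real.rpow_natCast (D / M),
      ← Real.rpow_mul (by positivity)]
    congr 1
    · rw [Real.rpow_def_of_pos (by positivity), Real.log_pow]
      congr 1
      push_cast
      field_simp
    · congr 1
      rw [hp₀]; push_cast; ring
  rw [e1]
  have key : (D / M) ^ p₀ ≤ (2 * Metric.infDist θ S / M) ^ p +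
      if M / 2 ≤ ‖z‖ then (2 * ‖z‖ / M) ^ p₀ else 0 := by
    by_cases hc : D / 2 ≤ Metric.infDist θ S
    · have h1 : (D / M) ^ p₀ ≤ (D / M) ^ p := Real.rpow_le_rpow_of_exponent_le hDM hp
      have h2 : (D / M) ^ p ≤ (2 * Metric.infDist θ S / M) ^ p := by
        refine Real.rpow_le_rpow (by positivity) ?_ (hp₀0.trans hp)
        gcongr; linarith
      linarith
    · rw [not_le] at hc
      have hz : D / 2 ≤ ‖z‖ := by linarith
      rw [if_pos (by linarith)]
      have h2 : (D / M) ^ p₀ ≤ (2 * ‖z‖ / M) ^ p₀ := by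
        refine Real.rpow_le_rpow (by positivity) ?_ hp₀0
        gcongr; linarith
      linarith
  nlinarith [Real.exp_pos 1]

lemma two_mul_distMoment_div_rpow (G : Measure (EuclideanSpace ℝ (Fin d))) {p : ℝ} (hp : 0 < p) :
    (2 * distMoment p S G / ENNReal.ofReal M) ^ p =
      ∫⁻ θ, (2 * ENNReal.ofReal (Metric.infDist θ S) / ENNReal.ofReal M) ^ p ∂G := by
  have h : ∀ a : ℝ≥0∞, (2 * a / ENNReal.ofReal M) ^ p = (2 / ENNReal.ofReal M) ^ p * a ^ p := by
    intro a
    rw [ENNReal.mul_div_right_comm, ENNReal.mul_rpow_of_nonneg _ _ hp.le]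
  simp_rw [h]
  rw [lintegral_const_mul, distMoment, ← ENNReal.rpow_mul, one_div_mul_cancel hp.ne',
    ENNReal.rpow_one]
  exact ((Metric.continuous_infDist_pt S).measurable.ennreal_ofReal).pow_const p

lemma lintegral_outlierWeight_rpow_le (hn : 2 ≤ n) (hM : 0 < M) {p : ℝ}
    (hp : ((d : ℝ) + 1) / (2 * Real.log n) ≤ p) (G : Measure (EuclideanSpace ℝ (Fin d)))
    [IsProbabilityMeasure G] {τ : ℝ≥0∞}
    (hτ : ∫⁻ z, ENNReal.ofReal (stdGaussianDensity d z) *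
        ENNReal.ofReal (if M / 2 ≤ ‖z‖ then (2 * ‖z‖ / M) ^ (((d : ℝ) + 1) / (2 * Real.log n))
          else 0) ≤ τ) :
    ∫⁻ x, ENNReal.ofReal (outlierWeight n M S x ^ (1 / (2 * Real.log n))) ∂(mixtureLaw G) ≤
      1 + ENNReal.ofReal (Real.exp 1) *
        ((2 * distMoment p S G / ENNReal.ofReal M) ^ p + τ) := by
  have hL := half_le_log_natCast hn
  have hp0 : 0 < p := lt_of_lt_of_le (by positivity) hp
  have hm : Measurable fun x => ENNReal.ofReal (outlierWeight n M S x ^ (1 / (2 * Real.log n))) :=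
    (measurable_outlierWeight.pow_const _).ennreal_ofReal
  have hφ : Measurable fun z => ENNReal.ofReal (stdGaussianDensity d z) :=
    continuous_stdGaussianDensity.measurable.ennreal_ofReal
  set A : EuclideanSpace ℝ (Fin d) → ℝ≥0∞ := fun θ =>
    (2 * ENNReal.ofReal (Metric.infDist θ S) / ENNReal.ofReal M) ^ p with hA
  have hAm : Measurable A := by
    have := ((Metric.continuous_infDist_pt S).measurable.ennreal_ofReal)
    fun_prop
  set B : EuclideanSpace ℝ (Fin d) → ℝ := fun z =>
    if M / 2 ≤ ‖z‖ then (2 * ‖z‖ / M) ^ (((d : ℝ) + 1) / (2 * Real.log n)) else 0 with hB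
  have hBm : Measurable B :=
    Measurable.ite (measurableSet_le measurable_const measurable_norm) (by fun_prop)
      measurable_const
  have hφB : Measurable fun z => ENNReal.ofReal (stdGaussianDensity d z) * ENNReal.ofReal (B z) :=
    hφ.mul hBm.ennreal_ofReal
  have hB0 : ∀ z, 0 ≤ B z := fun z => by
    simp only [hB]; split_ifs <;> positivity
  have hpt : ∀ θ z, ENNReal.ofReal (outlierWeight n M S (θ + z) ^ (1 / (2 * Real.log n))) ≤
      1 + ENNReal.ofReal (Real.exp 1) * (A θ + ENNReal.ofReal (B z)) := by
    intro θ z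
    have hθ0 : 0 ≤ Metric.infDist θ S := Metric.infDist_nonneg
    have e : A θ = ENNReal.ofReal ((2 * Metric.infDist θ S / M) ^ p) := by
      rw [← ENNReal.ofReal_rpow_of_nonneg (by positivity) hp0.le, ENNReal.ofReal_div_of_pos hM,
        ENNReal.ofReal_mul (by norm_num), ENNReal.ofReal_ofNat]
    rw [e, ← ENNReal.ofReal_add (by positivity) (hB0 z), ← ENNReal.ofReal_mul (by positivity),
      ← ENNReal.ofReal_one, ← ENNReal.ofReal_add (by norm_num)
        (mul_nonneg (by positivity) (add_nonneg (by positivity) (hB0 z)))]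
    exact ENNReal.ofReal_le_ofReal (outlierWeight_rpow_le hn hM hp θ z)
  rw [lintegral_mixtureLaw_eq_lintegral_lintegral G hm, two_mul_distMoment_div_rpow G hp0]
  set E := ENNReal.ofReal (Real.exp 1)
  calc _ ≤ ∫⁻ θ, ∫⁻ z, (ENNReal.ofReal (stdGaussianDensity d z) * (1 + E * A θ) +
          E * (ENNReal.ofReal (stdGaussianDensity d z) * ENNReal.ofReal (B z))) ∂volume ∂G := by
        refine lintegral_mono fun θ => lintegral_mono fun z => ?_
        refine (mul_le_mul_right (hpt θ z) _).trans_eq (by ring)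
    _ = ∫⁻ θ, (1 + E * A θ + E * ∫⁻ z, ENNReal.ofReal (stdGaussianDensity d z) *
          ENNReal.ofReal (B z)) ∂G := by
        refine lintegral_congr fun θ => ?_
        rw [lintegral_add_left (hφ.mul_const _), lintegral_mul_const _ hφ,
          lintegral_stdGaussianDensity, one_mul,
          lintegral_const_mul _ hφB]
    _ ≤ ∫⁻ θ, (1 + E * A θ + E * τ) ∂G := by gcongr
    _ = _ := by
        rw [lintegral_add_right _ measurable_const, lintegral_add_left measurable_const,
          lintegral_const_mul _ hAm]
        simp only [lintegral_const, measure_univ, mul_one]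
        ring

lemma lintegral_outlierWeight_rpow_le_iInf (hn : 2 ≤ n) (hM : 0 < M)
    (G : Measure (EuclideanSpace ℝ (Fin d))) [IsProbabilityMeasure G] {τ : ℝ≥0∞}
    (hτ : ∫⁻ z, ENNReal.ofReal (stdGaussianDensity d z) *
        ENNReal.ofReal (if M / 2 ≤ ‖z‖ then (2 * ‖z‖ / M) ^ (((d : ℝ) + 1) / (2 * Real.log n))
          else 0) ≤ τ) :
    ∫⁻ x, ENNReal.ofReal (outlierWeight n M S x ^ (1 / (2 * Real.log n))) ∂(mixtureLaw G) ≤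
      1 + ENNReal.ofReal (Real.exp 1) *
        ((⨅ (p : ℝ) (_ : ((d : ℝ) + 1) / (2 * Real.log n) ≤ p),
          (2 * distMoment p S G / ENNReal.ofReal M) ^ p) + τ) := by
  set E := ENNReal.ofReal (Real.exp 1)
  have hE0 : E ≠ 0 := by simp [E, Real.exp_pos]
  have hE : E ≠ ⊤ := ENNReal.ofReal_ne_top
  -- Solve for the infimum, so that the claim becomes a lower bound to be checked for each `p`.
  rw [← tsub_le_iff_left, mul_comm E, ← ENNReal.div_le_iff hE0 hE, ← tsub_le_iff_right]
  refine le_iInf₂ fun p hp => ?_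
  rw [tsub_le_iff_right, ENNReal.div_le_iff hE0 hE, mul_comm _ E, tsub_le_iff_left]
  exact lintegral_outlierWeight_rpow_le hn hM hp G hτ

/-- The product of the outlier weights is rarely large. -/
lemma measure_exp_le_prod_outlierWeight_le {Ω : Type*} [MeasurableSpace Ω] {P : Measure Ω}
    [IsProbabilityMeasure P] (hn : 2 ≤ n) (hM : 0 < M)
    {G : Fin n → Measure (EuclideanSpace ℝ (Fin d))}
    (hG : ∀ i, IsProbabilityMeasure (G i)) {X : Fin n → Ω → EuclideanSpace ℝ (Fin d)}
    (hX : ∀ i, HasLaw (X i) (mixtureLaw (G i)) P) (hI : iIndepFun X P) {τ I : ℝ} (hτ0 : 0 ≤ τ)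
    (hI0 : 0 ≤ I)
    (hτ : ∫⁻ z, ENNReal.ofReal (stdGaussianDensity d z) *
        ENNReal.ofReal (if M / 2 ≤ ‖z‖ then (2 * ‖z‖ / M) ^ (((d : ℝ) + 1) / (2 * Real.log n))
          else 0) ≤ ENNReal.ofReal (τ / n))
    (hinf : (⨅ (p : ℝ) (_ : ((d : ℝ) + 1) / (2 * Real.log n) ≤ p),
          (2 * distMoment p S (averageMeasure G) / ENNReal.ofReal M) ^ p) = ENNReal.ofReal I)
    (c : ℝ) :
    P {ω | ENNReal.ofReal (Real.exp c) ≤ ∏ i, ENNReal.ofReal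
        (outlierWeight n M S (X i ω) ^ (1 / (2 * Real.log n)))} ≤
      ENNReal.ofReal (Real.exp (Real.exp 1 * (n * I + τ) - c)) := by
  have hn0 : n ≠ 0 := by omega
  have hn1 : (0 : ℝ) < n := by positivity
  have := isProbabilityMeasure_averageMeasure G hn0 hG
  have hm : Measurable fun x => ENNReal.ofReal (outlierWeight n M S x ^ (1 / (2 * Real.log n))) :=
    (measurable_outlierWeight.pow_const _).ennreal_ofReal
  have hsum : ∑ i, ∫⁻ x, ENNReal.ofReal (outlierWeight n M S x ^ (1 / (2 * Real.log n)))
      ∂(mixtureLaw (G i)) ≤ ENNReal.ofReal (n * (1 + Real.exp 1 * (I + τ / n))) := by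
    rw [sum_lintegral_mixtureLaw G hn0 hG hm, ENNReal.ofReal_mul hn1.le, ENNReal.ofReal_natCast]
    gcongr
    refine (lintegral_outlierWeight_rpow_le_iInf hn hM _ hτ).trans_eq ?_
    rw [hinf, ← ENNReal.ofReal_add hI0 (by positivity), ← ENNReal.ofReal_mul (by positivity),
      ← ENNReal.ofReal_one, ← ENNReal.ofReal_add (by norm_num) (by positivity)]
  refine (measure_ofReal_exp_le_prod_le hX hI hm (by positivity) hsum c).trans
    (ENNReal.ofReal_le_ofReal (Real.exp_le_exp.2 (le_of_eq ?_)))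
  rw [Fintype.card_fin]
  field_simp
  ring

end OutlierWeight

/-! ### Metric entropy of Gaussian mixtures -/

section Entropy

lemma sqrt_ten_log_bounds {n : ℕ} (hn : 2 ≤ n) {M : ℝ} (hM : √(10 * Real.log n) ≤ M) :
    1 / 2 ≤ √(Real.log n) ∧ √(Real.log n) / 2 + 1 ≤ M ∧ √(Real.log n) ≤ M := by
  have hL := half_le_log_natCast hn
  have h1 : 3 * √(Real.log n) ≤ M := by
    refine le_trans ?_ hM
    refine Real.le_sqrt_of_sq_le ?_
    rw [mul_pow, Real.sq_sqrt (by linarith)]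
    linarith
  have h2 : 1 / 2 ≤ √(Real.log n) := by
    refine Real.le_sqrt_of_sq_le ?_
    linarith
  refine ⟨h2, by linarith, by linarith⟩

/-- The metric entropy of Gaussian mixtures in the uniform norm on a neighbourhood of `S`. -/
lemma exists_mixtureDensity_entropy_le (d : ℕ) :
    ∃ C : ℝ, 0 < C ∧ ∀ n : ℕ, 2 ≤ n → ∀ M : ℝ, √(10 * Real.log n) ≤ M →
      ∀ S : Set (EuclideanSpace ℝ (Fin d)), S.Nonempty → IsCompact S →
      ∀ F : Set (ProbabilityMeasure (EuclideanSpace ℝ (Fin d))),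
        ∃ T : Finset (ProbabilityMeasure (EuclideanSpace ℝ (Fin d))), ↑T ⊆ F ∧
          (T.card : ℝ) ≤ Real.exp (C * (volume.real {x | Metric.infDist x S ≤ 1} * M ^ d *
            √(Real.log n) ^ (d + 2))) ∧
          ∀ G ∈ F, ∃ H ∈ T, ∀ x, Metric.infDist x S ≤ M →
            |mixtureDensity (G : Measure (EuclideanSpace ℝ (Fin d))) x -
              mixtureDensity (H : Measure (EuclideanSpace ℝ (Fin d))) x| ≤ 1 / (n : ℝ) ^ 2 := by
  set ω := volume.real (Metric.ball (0 : EuclideanSpace ℝ (Fin d)) 1) with hωdef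
  have hω : 0 < ω := volumeReal_unitBall_pos
  set c : ℝ := 16 * d + 8 with hc
  have hc0 : 0 < c := by positivity
  refine ⟨8 ^ d / ω * c ^ d * (6 + d * c), by positivity, fun n hn M hM S hne hS F => ?_⟩
  have hL := half_le_log_natCast hn
  obtain ⟨ha, haM, haM'⟩ := sqrt_ten_log_bounds hn hM
  set L := Real.log n with hLdef
  set a := √L with hadef
  have ha0 : 0 < a := by linarith
  have hM0 : 0 < M := by linarith
  have haL : a ^ 2 = L := Real.sq_sqrt (by linarith)
  have hn0 : (0 : ℝ) < n := by positivity
  have hnL : (n : ℝ) = Real.exp L := (Real.exp_log hn0).symm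
  -- With balls of radius `a = √L` there are of order `(M / a)^d · v` centers, each with `m ^ d`, of
  -- order `L ^ d`, coordinates, each costing order `L` in log-cardinality. The product is of order
  -- `v * M ^ d * a ^ (d + 2)`.
  obtain ⟨N, hN, hNc⟩ := exists_net_thickening hS hne ha0 haM
  set v := volume.real {x | Metric.infDist x S ≤ 1} with hv
  have hv0 : 0 ≤ v := measureReal_nonneg
  -- Then `a² - m / 2 ≤ -(8 d + 2) L`: the part `8 d L` absorbs the factor `4 d`, and `2 L` leaves
  -- `n⁻²`. The ceiling adds at most `1 ≤ 2 L`, whence `c = 16 d + 8`.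
  set m := ⌈(16 * d + 6) * L⌉₊ with hm
  have hm1 : (16 * d + 6) * L ≤ m := Nat.le_ceil _
  have hm2 : (m : ℝ) ≤ c * L := by
    have := (Nat.ceil_lt_add_one (show 0 ≤ (16 * (d : ℝ) + 6) * L by positivity)).le
    nlinarith
  have hm0 : (1 : ℝ) ≤ m := by nlinarith [show (0 : ℝ) ≤ d by positivity]
  have hmpos : (0 : ℝ) < m := by linarith
  set w : ℝ := 1 / (2 * m ^ d * n ^ 2) with hw
  have hw0 : 0 < w := by positivity
  obtain ⟨T, hTF, hTc, hT⟩ := exists_finset_mixtureDensity_net (d := d) m (a := a) hw0 N F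
  refine ⟨T, hTF, hTc.trans ?_, fun G hG => ?_⟩
  -- The left side is at most `6 m^d n²`, with `6 ≤ e^(4L)`, `m^d ≤ e^(dcL)` and `n² = e^(2L)`.
  · have h1 : 2 / w + 2 ≤ Real.exp ((6 + d * c) * L) := by
      have e : 2 / w = 4 * (m : ℝ) ^ d * n ^ 2 := by rw [hw]; field_simp; norm_num
      have h2 : (2 : ℝ) ≤ 2 * ((m : ℝ) ^ d * n ^ 2) := by
        have h3 : (1 : ℝ) ≤ m ^ d := one_le_pow₀ hm0
        have h4 : (1 : ℝ) ≤ n ^ 2 := one_le_pow₀ (by exact_mod_cast (by omega : 1 ≤ n))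
        nlinarith
      have h5 : (m : ℝ) ^ d ≤ Real.exp (d * (c * L)) := by
        rw [Real.exp_nat_mul]
        gcongr
        linarith [Real.add_one_le_exp (c * L)]
      have h6 : (6 : ℝ) ≤ Real.exp (4 * L) := by
        have h7 : (2.7 : ℝ) ^ 2 ≤ Real.exp 1 ^ 2 := by
          gcongr; linarith [Real.exp_one_gt_d9]
        have h8 : Real.exp 1 ^ 2 ≤ Real.exp (4 * L) := by
          rw [← Real.exp_nat_mul, Real.exp_le_exp]; push_cast; linarith
        linarith [show (6 : ℝ) ≤ 2.7 ^ 2 by norm_num]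
      calc 2 / w + 2 ≤ 6 * ((m : ℝ) ^ d * n ^ 2) := by rw [e]; linarith
        _ ≤ Real.exp (4 * L) * (Real.exp (d * (c * L)) * Real.exp L ^ 2) := by
            rw [hnL]; gcongr
        _ = _ := by
            rw [← Real.exp_nat_mul, ← Real.exp_add, ← Real.exp_add]
            congr 1; push_cast; ring
    calc (2 / w + 2) ^ (N.card * m ^ d)
        ≤ Real.exp ((6 + d * c) * L) ^ (N.card * m ^ d) := by gcongr
      _ = Real.exp (N.card * m ^ d * ((6 + d * c) * L)) := by
          rw [← Real.exp_nat_mul]; push_cast; rfl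
      _ ≤ _ := by
          refine Real.exp_le_exp.2 ?_
          have hN' : (N.card : ℝ) ≤ (8 * M / a) ^ d * v / ω := by rwa [le_div_iff₀ hω]
          calc N.card * (m : ℝ) ^ d * ((6 + d * c) * L)
              ≤ ((8 * M / a) ^ d * v / ω) * (c * L) ^ d * ((6 + d * c) * L) := by gcongr
            _ = 8 ^ d / ω * c ^ d * (6 + d * c) * (v * M ^ d * a ^ (d + 2)) := by
                rw [← haL, div_pow, mul_pow, mul_pow, pow_add a d 2, ← pow_mul, two_mul, pow_add]
                field_simp
  · obtain ⟨H, hH, h⟩ := hT G hG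
    refine ⟨H, hH, fun x hx => (h x ?_).trans ?_⟩
    · exact hN x hx
    · have e : (m : ℝ) ^ d * w = 1 / n ^ 2 / 2 := by rw [hw]; field_simp
      have h1 : 4 * d * Real.exp (a ^ 2 - m / 2) ≤ 1 / (n : ℝ) ^ 2 := by
        have h2 : (4 * d : ℝ) ≤ Real.exp (8 * d * L) := by
          have : (4 * d : ℝ) ≤ 8 * d * L := by nlinarith [show (0 : ℝ) ≤ d by positivity]
          linarith [Real.add_one_le_exp (8 * d * L)]
        calc 4 * d * Real.exp (a ^ 2 - m / 2)
            ≤ Real.exp (8 * d * L) * Real.exp (a ^ 2 - m / 2) := by gcongr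
          _ ≤ Real.exp (-(2 * L)) := by
              rw [← Real.exp_add, Real.exp_le_exp, haL]; linarith
          _ = 1 / (n : ℝ) ^ 2 := by
              rw [hnL, Real.exp_neg, ← Real.exp_nat_mul, one_div]; norm_num
      rw [e]
      linarith

end Entropy

/-! ### The rate dominates the lower-order terms -/

section RateFacts

variable {d n : ℕ} {S : Set (EuclideanSpace ℝ (Fin d))} {M : ℝ}

lemma rateSq_eq (hS : IsCompact S) (hne : S.Nonempty)
    (G : Measure (EuclideanSpace ℝ (Fin d))) :
    rateSq n M S G =
      ENNReal.ofReal (volume.real {x | Metric.infDist x S ≤ 1} * M ^ d *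
        √(Real.log n) ^ (d + 2) / n) +
      ENNReal.ofReal (Real.log n) *
        ⨅ (p : ℝ) (_ : ((d : ℝ) + 1) / (2 * Real.log n) ≤ p),
          (2 * distMoment p S G / ENNReal.ofReal M) ^ p := by
  rw [rateSq]
  congr 1
  rw [← ofReal_measureReal (isBounded_setOf_infDist_le hS.isBounded hne 1).measure_lt_top.ne,
    ← ENNReal.ofReal_mul measureReal_nonneg]
  congr 1
  ring

/-- `S^1` contains a unit ball and `M ≥ √L`, so the right side is at least a multiple of `L^(d +
1)`. This dominates `L²` exactly because `d ≥ 1` and `L` is bounded below. -/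
lemma exists_lower_order_le (d : ℕ) (hd : 1 ≤ d) :
    ∃ C : ℝ, 0 < C ∧ ∀ n : ℕ, 2 ≤ n → ∀ M : ℝ, √(10 * Real.log n) ≤ M →
      ∀ S : Set (EuclideanSpace ℝ (Fin d)), S.Nonempty → IsCompact S →
        volume.real {x | Metric.infDist x S ≤ 1} * M ^ d + Real.log n ^ 2 + Real.log n + 1 ≤
          C * (volume.real {x | Metric.infDist x S ≤ 1} * M ^ d * √(Real.log n) ^ (d + 2)) := by
  set ω := volume.real (Metric.ball (0 : EuclideanSpace ℝ (Fin d)) 1) with hωdef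
  have hω : 0 < ω := volumeReal_unitBall_pos
  refine ⟨2 ^ (d + 2) + 7 * 2 ^ d / ω, by positivity, fun n hn M hM S hne hS => ?_⟩
  have hL := half_le_log_natCast hn
  obtain ⟨ha, -, haM⟩ := sqrt_ten_log_bounds hn hM
  set L := Real.log n with hLdef
  set a := √L with hadef
  have ha0 : 0 < a := by linarith
  have haL : a ^ 2 = L := Real.sq_sqrt (by linarith)
  set v := volume.real {x | Metric.infDist x S ≤ 1} with hv
  have hv0 : 0 ≤ v := measureReal_nonneg
  have hωv : ω ≤ v := volumeReal_unitBall_le hS hne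
  have hM0 : 0 < M := by linarith
  have h1 : v * M ^ d ≤ 2 ^ (d + 2) * (v * M ^ d * a ^ (d + 2)) := by
    have h2 : 1 ≤ (2 : ℝ) ^ (d + 2) * a ^ (d + 2) := by
      rw [← mul_pow]; exact one_le_pow₀ (by linarith)
    calc v * M ^ d = v * M ^ d * 1 := (mul_one _).symm
      _ ≤ v * M ^ d * (2 ^ (d + 2) * a ^ (d + 2)) := by gcongr
      _ = _ := by ring
  have h2 : L ^ 2 ≤ 2 ^ d / ω * (v * M ^ d * a ^ (d + 2)) := by
    obtain ⟨k, rfl⟩ : ∃ k, d = k + 1 := ⟨d - 1, by omega⟩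
    have h3 : 1 ≤ (2 : ℝ) ^ (k + 1) * L ^ k := by
      have h4 : 1 ≤ (2 : ℝ) ^ k * L ^ k := by
        rw [← mul_pow]; exact one_le_pow₀ (by linarith)
      rw [pow_succ]; linarith
    calc L ^ 2 = L ^ 2 * 1 := (mul_one _).symm
      _ ≤ L ^ 2 * (2 ^ (k + 1) * L ^ k) := by gcongr
      _ = 2 ^ (k + 1) / ω * (ω * a ^ (k + 1) * a ^ (k + 1 + 2)) := by
          rw [← haL]; field_simp; ring
      _ ≤ 2 ^ (k + 1) / ω * (v * M ^ (k + 1) * a ^ (k + 1 + 2)) := by gcongr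
  have h3 : L ^ 2 + L + 1 ≤ 7 * L ^ 2 := by nlinarith
  calc v * M ^ d + L ^ 2 + L + 1 ≤ v * M ^ d + 7 * L ^ 2 := by linarith
    _ ≤ 2 ^ (d + 2) * (v * M ^ d * a ^ (d + 2)) +
        7 * (2 ^ d / ω * (v * M ^ d * a ^ (d + 2))) := by gcongr
    _ = _ := by ring

lemma rateSq_ne_zero (hd : 1 ≤ d) (hn : 2 ≤ n) (hM : √(10 * Real.log n) ≤ M)
    (hS : IsCompact S) (hne : S.Nonempty) (G : Measure (EuclideanSpace ℝ (Fin d))) :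
    rateSq n M S G ≠ 0 := by
  obtain ⟨C, hC, h⟩ := exists_lower_order_le d hd
  have hM2 := two_le_of_sqrt_le hn hM
  have hL := half_le_log_natCast hn
  have hn0 : (0 : ℝ) < n := by positivity
  have h1 := h n hn M hM S hne hS
  rw [rateSq_eq hS hne]
  refine (ne_of_gt (lt_of_lt_of_le ?_ (self_le_add_right _ _)))
  rw [ENNReal.ofReal_pos]
  refine div_pos (pos_of_mul_pos_right (lt_of_lt_of_le ?_ h1) hC.le) hn0
  have : 0 ≤ volume.real {x | Metric.infDist x S ≤ 1} * M ^ d := by positivity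
  positivity

end RateFacts

/-! ### The tail bound and its integration -/

section Tail

/-- If both alternatives fail, then `∏ r < exp (-a)` and `∏ W < exp b`, contradicting the lower
bound on `∏ p`. -/
lemma exp_le_prod_sqrt_or_exp_le_prod_rpow {ι : Type*} [Fintype ι] {p r W : ι → ℝ} {a b l : ℝ}
    (hl : 0 < l) (hp : ∀ i, 0 ≤ p i) (hr : ∀ i, 0 ≤ r i) (hW : ∀ i, 0 < W i)
    (hpr : ∀ i, p i ≤ r i * W i) (h : Real.exp (b - a) ≤ ∏ i, p i) :
    Real.exp (-(a / 2)) ≤ ∏ i, √(r i) ∨ Real.exp (l * b) ≤ ∏ i, W i ^ l := by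
  by_contra! hc
  obtain ⟨h1, h2⟩ := hc
  have hr' : ∏ i, r i < Real.exp (-a) := by
    calc ∏ i, r i = (∏ i, √(r i)) ^ 2 := by
          rw [← Finset.prod_pow]
          exact Finset.prod_congr rfl fun i _ => (Real.sq_sqrt (hr i)).symm
      _ < Real.exp (-(a / 2)) ^ 2 :=
          pow_lt_pow_left₀ h1 (Finset.prod_nonneg fun _ _ => Real.sqrt_nonneg _) two_ne_zero
      _ = Real.exp (-a) := by rw [← Real.exp_nat_mul]; congr 1; push_cast; ring
  have hW0 : 0 < ∏ i, W i := Finset.prod_pos fun i _ => hW i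
  have hW' : ∏ i, W i < Real.exp b := by
    rw [Real.finsetProd_rpow _ _ fun i _ => (hW i).le, mul_comm l b, Real.exp_mul] at h2
    exact (Real.rpow_lt_rpow_iff hW0.le (Real.exp_pos _).le hl).1 h2
  have h3 : ∏ i, p i ≤ (∏ i, r i) * ∏ i, W i := by
    rw [← Finset.prod_mul_distrib]
    exact Finset.prod_le_prod (fun i _ => hp i) fun i _ => hpr i
  have h4 : (∏ i, r i) * ∏ i, W i < Real.exp (-a) * Real.exp b :=
    mul_lt_mul'' hr' hW' (Finset.prod_nonneg fun i _ => hr i) hW0.le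
  rw [← Real.exp_add, show -a + b = b - a by ring] at h4
  linarith

lemma ofReal_exp_le_prod_ofReal {ι : Type*} [Fintype ι] {y : ι → ℝ} (hy : ∀ i, 0 ≤ y i) {c : ℝ}
    (h : Real.exp c ≤ ∏ i, y i) :
    ENNReal.ofReal (Real.exp c) ≤ ∏ i, ENNReal.ofReal (y i) := by
  rw [← ENNReal.ofReal_prod_of_nonneg fun i _ => hy i]
  exact ENNReal.ofReal_le_ofReal h

lemma LikelihoodRatioBound.exp_le {d n : ℕ} {C α β e : ℝ} (he : 0 ≤ e)
    {x : Fin n → EuclideanSpace ℝ (Fin d)} {f g : EuclideanSpace ℝ (Fin d) → ℝ}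
    (hfg : ∀ i, 0 ≤ f (x i) / g (x i))
    (h : LikelihoodRatioBound C α β (ENNReal.ofReal e) x f g) :
    Real.exp (C * (β - α) / min (1 - α) β * n * e) ≤ ∏ i, f (x i) / g (x i) := by
  unfold LikelihoodRatioBound at h
  rw [EReal.coe_ennreal_ofReal, max_eq_left he, ← EReal.coe_mul, EReal.exp_coe,
    ENNReal.ofReal_le_ofReal_iff (Finset.prod_nonneg fun i _ => hfg i)] at h
  exact h

/-- Exponent bookkeeping for the union over the net: `C₂ * Q` is the entropy, `u` stands for `s n
ε_n²`, and the gain `(1 - α)Γ/2` pays for everything. `D` is the part of `K` reserved for the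
outliers. -/
lemma union_exponent_le {C₁ C₂ C₄ D K V Q u s L Γ α : ℝ} (hC₁ : 0 ≤ C₁) (hC₂ : 0 ≤ C₂)
    (hC₄ : 0 ≤ C₄) (hu : 0 ≤ u) (hD : 0 ≤ D) (hK : K = 2 * (C₂ + (C₁ + 1) * C₄ + C₄ + D))
    (hV : V ≤ C₄ * Q)
    (h1 : 1 ≤ C₄ * Q) (hQ : Q ≤ u) (hs : s * L ≤ C₄ * u) (hα : K * u ≤ (1 - α) * Γ) :
    C₂ * Q + (-(Γ / 2) + (C₁ * V + 1) / 2 - -(α * Γ / 2)) ≤ -(s * L) := by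
  have h0 : C₄ * Q ≤ C₄ * u := mul_le_mul_of_nonneg_left hQ hC₄
  have h2 : C₁ * V ≤ C₁ * (C₄ * u) := mul_le_mul_of_nonneg_left (by linarith) hC₁
  have h3 : C₂ * Q ≤ C₂ * u := mul_le_mul_of_nonneg_left hQ hC₂
  have h4 : 0 ≤ D * u := mul_nonneg hD hu
  have h5 : 0 ≤ C₁ * (C₄ * u) := mul_nonneg hC₁ (by linarith)
  rw [hK] at hα
  nlinarith

/-- The gain here is only `βΓ/(2L)`, so the inequality is multiplied by `L`. This explains the
factor `log n` before the infimum in the rate, and the need to dominate `L²`. -/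
lemma outlier_exponent_le {B C₃ C₄ E K J u s L Γ β : ℝ} (hL : 0 < L) (hC₃ : 0 ≤ C₃)
    (hE : 0 ≤ E) (hB : 0 ≤ B * u) (hK : K = 2 * (B + C₄ + E * (1 + C₃ * C₄)))
    (hJ : L * J ≤ u) (hL₄ : L ≤ C₄ * u) (hs : L * (s * L) ≤ C₄ * u) (hβ : K * u ≤ β * Γ) :
    E * (J + C₃) - 1 / (2 * L) * (β * Γ) ≤ -(s * L) := by
  refine le_of_mul_le_mul_left ?_ hL
  have h1 : L * (1 / (2 * L) * (β * Γ)) = β * Γ / 2 := by field_simp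
  have h2 : E * (L * J + C₃ * L) ≤ E * (u + C₃ * (C₄ * u)) := by gcongr
  rw [mul_sub, h1]
  rw [hK] at hβ
  linarith

/-- The tail bound for the squared Hellinger distance. -/
theorem exists_hellingerSq_tail_le (d : ℕ) (hd : 1 ≤ d) :
    ∃ C : ℝ, 0 < C ∧ ∀ (n : ℕ) (_ : 2 ≤ n) (G : Fin n → Measure (EuclideanSpace ℝ (Fin d)))
      (_ : ∀ i, IsProbabilityMeasure (G i)) (Ω : Type*) (_ : MeasurableSpace Ω) (P : Measure Ω)
      (_ : IsProbabilityMeasure P) (X : Fin n → Ω → EuclideanSpace ℝ (Fin d))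
      (_ : ∀ i, HasLaw (X i) (mixtureLaw (G i)) P) (_ : iIndepFun X P)
      (S : Set (EuclideanSpace ℝ (Fin d))) (_ : S.Nonempty) (_ : IsCompact S)
      (M : ℝ) (_ : √(10 * Real.log n) ≤ M) (f : Ω → EuclideanSpace ℝ (Fin d) → ℝ)
      (_ : ∀ ω, f ω ∈ mixtureClass d) (α β : ℝ) (_ : 0 < β) (_ : β ≤ α) (_ : α < 1)
      (_ : rateSq n M S (averageMeasure G) ≠ ⊤)
      (_ : ∀ᵐ ω ∂P, LikelihoodRatioBound C α β (rateSq n M S (averageMeasure G))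
        (fun i => X i ω) (f ω) (mixtureDensity (averageMeasure G))) (s : ℝ) (_ : 1 ≤ s),
      P {ω | ENNReal.ofReal (s * (C / min (1 - α) β)) * rateSq n M S (averageMeasure G) ≤
          hellingerSq (f ω) (mixtureDensity (averageMeasure G))} ≤
        ENNReal.ofReal (2 * (n : ℝ) ^ (-s)) := by
  obtain ⟨C₁, hC₁, hweight⟩ := exists_lintegral_tailWeight_le d
  obtain ⟨C₂, hC₂, hentropy⟩ := exists_mixtureDensity_entropy_le d
  obtain ⟨C₃, hC₃, htail⟩ := exists_lintegral_gaussian_tail_le d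
  obtain ⟨C₄, hC₄, hlow⟩ := exists_lower_order_le d hd
  set K : ℝ := 2 * (C₂ + (C₁ + 1) * C₄ + C₄ + Real.exp 1 * (1 + C₃ * C₄)) with hK
  have hK0 : 0 < K := by positivity
  refine ⟨K, hK0, ?_⟩
  intro n hn G hG Ω _ P _ X hX hXI S hne hS M hM f hf α β hβ hβα hα hfin hlr s hs
  have hn' : n ≠ 0 := by omega
  have hn0 : (0 : ℝ) < n := by positivity
  have hL := half_le_log_natCast hn
  have hM2 := two_le_of_sqrt_le hn hM
  have hM0 : 0 < M := by linarith
  have hGbar := isProbabilityMeasure_averageMeasure G hn' hG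
  have hrate := rateSq_eq (n := n) (M := M) hS hne (averageMeasure G)
  have hlow' := hlow n hn M hM S hne hS
  set J := ⨅ (p : ℝ) (_ : ((d : ℝ) + 1) / (2 * Real.log n) ≤ p),
          (2 * distMoment p S (averageMeasure G) / ENNReal.ofReal M) ^ p with hJdef
  set r := rateSq n M S (averageMeasure G) with hr
  set L := Real.log n with hLdef
  set V := volume.real {x | Metric.infDist x S ≤ 1} * M ^ d with hV
  set Q := V * √L ^ (d + 2) with hQ
  have hV0 : 0 ≤ V := by positivity
  have hJ : J ≠ ⊤ := by
    intro h
    rw [h, ENNReal.mul_top (by simp; linarith), add_top] at hrate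
    exact hfin hrate
  set I := J.toReal with hIr
  have hI0 : 0 ≤ I := ENNReal.toReal_nonneg
  have hI' : J = ENNReal.ofReal I := (ENNReal.ofReal_toReal hJ).symm
  set e := Q / n + L * I with he
  have hQ0 : 0 ≤ Q := by positivity
  have he0 : 0 ≤ e := by positivity
  have hre : r = ENNReal.ofReal e := by
    rw [hrate, hI', ← ENNReal.ofReal_mul (by linarith), ← ENNReal.ofReal_add (by positivity)
      (by positivity)]
  set q := n * e with hq
  have hqQ : q = Q + L * (n * I) := by rw [hq, he]; field_simp
  have hQq : Q ≤ q := by rw [hqQ]; linarith [show 0 ≤ L * (n * I) by positivity]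
  have hnI : L * (n * I) ≤ q := by rw [hqQ]; linarith
  set mn := min (1 - α) β with hmn
  have hmn0 : 0 < mn := lt_min (by linarith) hβ
  set R := s * (K / mn) * e with hR
  set Γ := n * R with hΓ
  have hΓ' : Γ = s * (K / mn) * q := by rw [hΓ, hR, hq]; ring
  have hq0 : 0 ≤ q := hQ0.trans hQq
  have hmul : ∀ y, mn ≤ y → K * (s * q) ≤ y * Γ := by
    intro y hy
    rw [hΓ']
    calc K * (s * q) = mn * (s * (K / mn) * q) := by field_simp
      _ ≤ _ := by gcongr
  have hα' := hmul (1 - α) (min_le_left _ _)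
  have hβ' := hmul β (min_le_right _ _)
  have hsq : q ≤ s * q := le_mul_of_one_le_left hq0 hs
  have hL0 : 0 < L := by linarith
  have hLsq : 0 ≤ L ^ 2 := sq_nonneg L
  have hV₄ : V ≤ C₄ * Q := by linarith
  have h1₄ : 1 ≤ C₄ * Q := by linarith
  have hL₄ : L ≤ C₄ * Q := by linarith
  have hLL₄ : L ^ 2 ≤ C₄ * Q := by linarith
  have hC₄q : C₄ * Q ≤ C₄ * (s * q) := mul_le_mul_of_nonneg_left (hQq.trans hsq) hC₄.le
  have hs0 : 0 ≤ s := by linarith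
  have hsC : s * (C₄ * Q) ≤ C₄ * (s * q) := by
    rw [mul_left_comm]
    exact mul_le_mul_of_nonneg_left (mul_le_mul_of_nonneg_left hQq hs0) hC₄.le
  have hsL : s * L ≤ C₄ * (s * q) := (mul_le_mul_of_nonneg_left hL₄ hs0).trans hsC
  have hsL₂ : L * (s * L) ≤ C₄ * (s * q) := by
    rw [mul_left_comm, ← pow_two]
    exact (mul_le_mul_of_nonneg_left hLL₄ hs0).trans hsC
  -- The net is taken inside the set of far competitors, so the affinity bound applies to each of
  -- its elements.
  let F : Set (ProbabilityMeasure (EuclideanSpace ℝ (Fin d))) :=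
    {H | ENNReal.ofReal R ≤ hellingerSq
      (mixtureDensity (H : Measure (EuclideanSpace ℝ (Fin d))))
      (mixtureDensity (averageMeasure G))}
  obtain ⟨T, hTF, hTc, hT⟩ := hentropy n hn M hM S hne hS F
  set h : EuclideanSpace ℝ (Fin d) → ℝ := fun x => 1 / (n : ℝ) ^ 2 * tailWeight M S x with hh
  have hh0 : ∀ x, 0 ≤ h x := fun x => mul_nonneg (by positivity) (tailWeight_pos hM0 x).le
  have hhm : Measurable h := measurable_tailWeight.const_mul _
  have hhB : ∫⁻ x, ENNReal.ofReal (h x) ≤ ENNReal.ofReal (C₁ * V / n ^ 2) := by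
    simp_rw [hh, ENNReal.ofReal_mul (show 0 ≤ 1 / (n : ℝ) ^ 2 by positivity)]
    rw [lintegral_const_mul _ measurable_tailWeight.ennreal_ofReal]
    refine (mul_le_mul_right (hweight S hS hne M (by linarith)) _).trans_eq ?_
    rw [← ENNReal.ofReal_mul (by positivity)]
    congr 1; ring
  let E₁ : ProbabilityMeasure (EuclideanSpace ℝ (Fin d)) → Set Ω := fun H =>
    {ω | ENNReal.ofReal (Real.exp (-(α * Γ / 2))) ≤ ∏ i, ENNReal.ofReal
        √((mixtureDensity (H : Measure (EuclideanSpace ℝ (Fin d))) (X i ω) + h (X i ω)) /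
          mixtureDensity (averageMeasure G) (X i ω))}
  let E₂ : Set Ω := {ω | ENNReal.ofReal (Real.exp (1 / (2 * L) * (β * Γ))) ≤
      ∏ i, ENNReal.ofReal (outlierWeight n M S (X i ω) ^ (1 / (2 * L)))}
  have hE₁ : ∀ H ∈ T, P (E₁ H) ≤ ENNReal.ofReal
      (Real.exp (-(n * R / 2) + (C₁ * V + 1) / 2 - -(α * Γ / 2))) := fun H hH =>
    measure_exp_le_prod_sqrt_ratio_le hn' hG hX hXI _ hh0 hhm (by positivity) hhB
      (hTF hH) _
  have hE₂ : P E₂ ≤ ENNReal.ofReal (Real.exp (Real.exp 1 * (n * I + C₃) -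
      1 / (2 * L) * (β * Γ))) :=
    measure_exp_le_prod_outlierWeight_le hn hM0 hG hX hXI hC₃.le hI0
      (htail n hn M hM) hI' _
  have hns : (n : ℝ) ^ (-s) = Real.exp (-(s * L)) := by
    rw [Real.rpow_def_of_pos hn0]; congr 1; ring
  -- The inclusion passes from the possibly non-measurable event about the estimator to events about
  -- a fixed finite net.
  have hsub : {ω | ENNReal.ofReal (s * (K / mn)) * r ≤
      hellingerSq (f ω) (mixtureDensity (averageMeasure G))} ≤ᵐ[P] ((⋃ H ∈ T, E₁ H) ∪ E₂ :) := by
    filter_upwards [hlr] with ω hω hmem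
    obtain ⟨F₀, hF₀, hfF⟩ := hf ω
    have hF : (⟨F₀, hF₀⟩ : ProbabilityMeasure (EuclideanSpace ℝ (Fin d))) ∈ F := by
      have h1 : ENNReal.ofReal (s * (K / mn)) * r ≤
        hellingerSq (f ω) (mixtureDensity (averageMeasure G)) := hmem
      rwa [hre, ← ENNReal.ofReal_mul (by positivity), hfF] at h1
    obtain ⟨H, hH, hFH⟩ := hT _ hF
    rw [hfF, hre] at hω
    have hg0 : ∀ x, 0 < mixtureDensity (averageMeasure G) x := mixtureDensity_pos _
    have hfg0 : ∀ i, 0 ≤ mixtureDensity F₀ (X i ω) /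
        mixtureDensity (averageMeasure G) (X i ω) := fun i =>
      div_nonneg (mixtureDensity_nonneg _ _) (hg0 _).le
    have hprod := hω.exp_le he0 hfg0
    have hexp : Real.exp (β * Γ - α * Γ) ≤ ∏ i, mixtureDensity F₀ (X i ω) /
        mixtureDensity (averageMeasure G) (X i ω) := by
      -- Since `β - α ≤ 0` and `s ≥ 1`, inserting the factor `s` only lowers the exponent.
      refine le_trans (Real.exp_le_exp.2 ?_) hprod
      have e1 : K * (β - α) / mn * n * e = -((α - β) * (K / mn * q)) := by rw [hq]; ring
      have e2 : β * Γ - α * Γ = -((α - β) * (K / mn * (s * q))) := by rw [hΓ']; ring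
      rw [e1, e2]
      refine neg_le_neg (mul_le_mul_of_nonneg_left ?_ (by linarith))
      gcongr
    have hr0 : ∀ i, 0 ≤ (mixtureDensity (H : Measure (EuclideanSpace ℝ (Fin d))) (X i ω) +
        h (X i ω)) / mixtureDensity (averageMeasure G) (X i ω) := fun i =>
      div_nonneg (add_nonneg (mixtureDensity_nonneg _ _) (hh0 _)) (hg0 _).le
    have hW0 := fun i => outlierWeight_pos (S := S) hn' hM0 (X i ω)
    rcases exp_le_prod_sqrt_or_exp_le_prod_rpow (l := 1 / (2 * L)) (by positivity) hfg0 hr0 hW0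
      (fun i => by
        rw [div_mul_eq_mul_div]
        exact div_le_div_of_nonneg_right (le_add_tailWeight_mul_outlierWeight hn' hM0
          (mixtureDensity_le_one F₀ _) (mixtureDensity_nonneg _ _) (hFH _)) (hg0 _).le)
      hexp with h1 | h1
    · refine Or.inl (Set.mem_iUnion₂.2 ⟨H, hH, ?_⟩)
      exact ofReal_exp_le_prod_ofReal (fun i => Real.sqrt_nonneg _) h1
    · exact Or.inr (ofReal_exp_le_prod_ofReal (fun i => Real.rpow_nonneg (hW0 i).le _) h1)
  have hb₁ : P (⋃ H ∈ T, E₁ H) ≤ ENNReal.ofReal ((n : ℝ) ^ (-s)) := by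
    refine (measure_biUnion_finset_le _ _).trans ((Finset.sum_le_card_nsmul _ _ _ hE₁).trans ?_)
    rw [nsmul_eq_mul, ← ENNReal.ofReal_natCast,
      ← ENNReal.ofReal_mul (Nat.cast_nonneg _), hns]
    refine ENNReal.ofReal_le_ofReal ((mul_le_mul_of_nonneg_right hTc (Real.exp_pos _).le).trans ?_)
    rw [← Real.exp_add, Real.exp_le_exp]
    exact union_exponent_le hC₁.le hC₂.le hC₄.le (mul_nonneg hs0 hq0) (by positivity) hK
      hV₄ h1₄ (hQq.trans hsq) hsL hα'
  have hb₂ : P E₂ ≤ ENNReal.ofReal ((n : ℝ) ^ (-s)) := by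
    refine hE₂.trans (ENNReal.ofReal_le_ofReal ?_)
    rw [hns, Real.exp_le_exp]
    exact outlier_exponent_le (by linarith) hC₃.le (Real.exp_pos 1).le (by positivity) hK
      (hnI.trans hsq) (hL₄.trans hC₄q) hsL₂ hβ'
  calc _ ≤ P ((⋃ H ∈ T, E₁ H) ∪ E₂) := measure_mono_ae hsub
    _ ≤ P (⋃ H ∈ T, E₁ H) + P E₂ := measure_union_le _ _
    _ ≤ ENNReal.ofReal ((n : ℝ) ^ (-s)) + ENNReal.ofReal ((n : ℝ) ^ (-s)) := add_le_add hb₁ hb₂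
    _ = _ := by
        rw [← ENNReal.ofReal_add (by positivity) (by positivity), two_mul]

/-- The mean of a nonnegative function, possibly not measurable, with geometric tails. -/
lemma lintegral_le_of_geometric_tail {Ω : Type*} [MeasurableSpace Ω] {P : Measure Ω}
    [IsProbabilityMeasure P] {Z : Ω → ℝ≥0∞} (hZ : ∀ ω, Z ω ≠ ⊤) {b : ℝ≥0∞} (hb0 : b ≠ 0)
    (hb : b ≠ ⊤)
    (h : ∀ k : ℕ, P {ω | ((k + 1 : ℕ) : ℝ≥0∞) * b ≤ Z ω} ≤ 2⁻¹ ^ k) :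
    ∫⁻ ω, Z ω ∂P ≤ 3 * b := by
  -- Measurable hulls of the level sets have the same measure. `Z` is at most `b` times one plus the
  -- number of levels `(k + 1) b` that it reaches.
  set A : ℕ → Set Ω := fun k => toMeasurable P {ω | ((k + 1 : ℕ) : ℝ≥0∞) * b ≤ Z ω} with hA
  have hAm : ∀ k, MeasurableSet (A k) := fun k => measurableSet_toMeasurable _ _
  have hpt : ∀ ω, Z ω ≤ b * (1 + ∑' k, (A k).indicator 1 ω) := by
    intro ω
    have hzb : Z ω / b ≠ ⊤ := ENNReal.div_ne_top (hZ ω) hb0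
    set y := (Z ω / b).toReal with hy
    have hy0 : 0 ≤ y := ENNReal.toReal_nonneg
    have hyz : ENNReal.ofReal y = Z ω / b := ENNReal.ofReal_toReal hzb
    set N := ⌊y⌋₊ with hN
    have hNZ : (N : ℝ≥0∞) * b ≤ Z ω := by
      rw [← ENNReal.le_div_iff_mul_le (Or.inl hb0) (Or.inl hb), ← hyz, ← ENNReal.ofReal_natCast]
      exact ENNReal.ofReal_le_ofReal (Nat.floor_le hy0)
    have hsum : (N : ℝ≥0∞) ≤ ∑' k, (A k).indicator 1 ω := by
      refine le_trans ?_ (ENNReal.sum_le_tsum (Finset.range N))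
      have : ∀ k ∈ Finset.range N, (A k).indicator (1 : Ω → ℝ≥0∞) ω = 1 := by
        intro k hk
        refine Set.indicator_of_mem (subset_toMeasurable _ _ ?_) _
        refine le_trans ?_ hNZ
        gcongr
        exact Finset.mem_range.1 hk
      rw [Finset.sum_congr rfl this]
      simp
    calc Z ω = b * (Z ω / b) := (ENNReal.mul_div_cancel hb0 hb).symm
      _ ≤ b * (1 + N) := by
          gcongr
          rw [← hyz, ← ENNReal.ofReal_natCast, ← ENNReal.ofReal_one,
            ← ENNReal.ofReal_add (by norm_num) (by positivity)]
          exact ENNReal.ofReal_le_ofReal (by linarith [Nat.lt_floor_add_one y])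
      _ ≤ _ := by gcongr
  have hm : ∀ k, Measurable ((A k).indicator (1 : Ω → ℝ≥0∞)) := fun k =>
    measurable_one.indicator (hAm k)
  calc ∫⁻ ω, Z ω ∂P ≤ ∫⁻ ω, b * (1 + ∑' k, (A k).indicator 1 ω) ∂P := lintegral_mono hpt
    _ = b * (1 + ∑' k, P (A k)) := by
        rw [lintegral_const_mul' _ _ hb,
          lintegral_add_left measurable_const, lintegral_tsum fun k => (hm k).aemeasurable]
        simp [hAm]
    _ ≤ b * (1 + ∑' k, 2⁻¹ ^ k) := by
        gcongr with k
        rw [hA, measure_toMeasurable]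
        exact h k
    _ = 3 * b := by
        rw [ENNReal.tsum_geometric, ENNReal.one_sub_inv_two, inv_inv, mul_comm]
        norm_num

end Tail

/-! ### Maximum likelihood estimators and the theorem -/

lemma IsNPMLE.likelihoodRatioBound {d n : ℕ} (hn : n ≠ 0)
    {x : Fin n → EuclideanSpace ℝ (Fin d)} {f : EuclideanSpace ℝ (Fin d) → ℝ}
    (hf : IsNPMLE x f) (G : Measure (EuclideanSpace ℝ (Fin d))) [IsProbabilityMeasure G]
    {C α β : ℝ} (hC : 0 ≤ C) (hβ : 0 < β) (hβα : β ≤ α) (hα : α < 1) (e : ℝ≥0∞) :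
    LikelihoodRatioBound C α β e x f (mixtureDensity G) := by
  obtain ⟨⟨F, hF, rfl⟩, hmax⟩ := hf
  have hn0 : (0 : ℝ) < n := by positivity
  have hF0 : ∀ x, 0 < mixtureDensity F x := mixtureDensity_pos F
  have hG0 : ∀ x, 0 < mixtureDensity G x := mixtureDensity_pos G
  have h1 : ∑ i, Real.log (mixtureDensity G (x i)) ≤ ∑ i, Real.log (mixtureDensity F (x i)) := by
    have := hmax (show mixtureDensity G ∈ mixtureClass d from ⟨G, inferInstance, rfl⟩)
    exact le_of_mul_le_mul_left this (by positivity)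
  have h2 : 1 ≤ ∏ i, mixtureDensity F (x i) / mixtureDensity G (x i) := by
    rw [Finset.prod_div_distrib, one_le_div (Finset.prod_pos fun i _ => hG0 _),
      ← Real.log_le_log_iff (Finset.prod_pos fun i _ => hG0 _) (Finset.prod_pos fun i _ => hF0 _),
      Real.log_prod fun i _ => (hG0 _).ne', Real.log_prod fun i _ => (hF0 _).ne']
    exact h1
  unfold LikelihoodRatioBound
  -- The exponent is nonpositive as `β ≤ α`. This includes `e = ∞`, where `0 * ∞ = 0` covers `α =
  -- β`.
  refine le_trans (EReal.exp_le_one_iff.2 ?_) (ENNReal.one_le_ofReal.2 h2)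
  refine mul_nonpos_of_nonpos_of_nonneg ?_ (EReal.coe_ennreal_nonneg e)
  have : 0 < min (1 - α) β := lt_min (by linarith) hβ
  refine EReal.coe_nonpos.2 (mul_nonpos_of_nonpos_of_nonneg ?_ hn0.le)
  exact div_nonpos_of_nonpos_of_nonneg (mul_nonpos_of_nonneg_of_nonpos hC (by linarith)) this.le

lemma rpow_half_sq (x : ℝ≥0∞) : (x ^ (1 / 2 : ℝ)) ^ 2 = x := by
  rw [← ENNReal.rpow_natCast, ← ENNReal.rpow_mul]
  norm_num

lemma two_mul_rpow_neg_le {n : ℕ} (hn : 2 ≤ n) (k : ℕ) :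
    ENNReal.ofReal (2 * (n : ℝ) ^ (-((k : ℝ) + 1))) ≤ 2⁻¹ ^ k := by
  have hn2 : (2 : ℝ) ≤ n := by exact_mod_cast hn
  have h : (2⁻¹ : ℝ≥0∞) ^ k = ENNReal.ofReal ((2⁻¹ : ℝ) ^ k) := by
    rw [ENNReal.ofReal_pow (by norm_num), ENNReal.ofReal_inv_of_pos (by norm_num),
      ENNReal.ofReal_ofNat]
  rw [h]
  refine ENNReal.ofReal_le_ofReal ?_
  rw [Real.rpow_neg (by positivity), ← Nat.cast_add_one, Real.rpow_natCast]
  calc 2 * ((n : ℝ) ^ (k + 1))⁻¹ ≤ 2 * ((2 : ℝ) ^ (k + 1))⁻¹ := by gcongr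
    _ = (2⁻¹ : ℝ) ^ k := by rw [pow_succ, inv_pow]; field_simp

theorem theorem2p1 (d : ℕ) (hd : 1 ≤ d) :
    ∃ C : ℝ, 0 < C ∧
      ∀ (n : ℕ) (_ : 2 ≤ n)
        (G : Fin n → Measure (EuclideanSpace ℝ (Fin d)))
        (_ : ∀ i, IsProbabilityMeasure (G i))
        (Ω : Type*) (_ : MeasurableSpace Ω) (P : Measure Ω) (_ : IsProbabilityMeasure P)
        (X : Fin n → Ω → EuclideanSpace ℝ (Fin d))
        (_ : ∀ i, HasLaw (X i) (mixtureLaw (G i)) P)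
        (_ : iIndepFun X P)
        (S : Set (EuclideanSpace ℝ (Fin d))) (_ : S.Nonempty) (_ : IsCompact S)
        (M : ℝ) (_ : Real.sqrt (10 * Real.log n) ≤ M)
        (fhat : (Fin n → EuclideanSpace ℝ (Fin d)) → EuclideanSpace ℝ (Fin d) → ℝ)
        (_ : ∀ x, fhat x ∈ mixtureClass d)
        (α β : ℝ) (_ : 0 < β) (_ : β ≤ α) (_ : α < 1),
        ((∀ᵐ ω ∂P, LikelihoodRatioBound C α β (rateSq n M S (averageMeasure G))
              (fun i => X i ω) (fhat fun i => X i ω) (mixtureDensity (averageMeasure G))) →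
          (∀ t : ℝ, 1 ≤ t →
            P {ω | ENNReal.ofReal (t * Real.sqrt C / Real.sqrt (min (1 - α) β)) *
                    rate n M S (averageMeasure G) ≤
                  hellinger (fhat fun i => X i ω) (mixtureDensity (averageMeasure G))} ≤
              ENNReal.ofReal (2 * (n : ℝ) ^ (-t ^ 2))) ∧
          ∫⁻ ω, hellingerSq (fhat fun i => X i ω) (mixtureDensity (averageMeasure G)) ∂P ≤
            ENNReal.ofReal (4 * C / min (1 - α) β) * rateSq n M S (averageMeasure G)) ∧
        ((∀ᵐ ω ∂P, IsNPMLE (fun i => X i ω) (fhat fun i => X i ω)) →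
          ∀ᵐ ω ∂P, LikelihoodRatioBound C α β (rateSq n M S (averageMeasure G))
              (fun i => X i ω) (fhat fun i => X i ω) (mixtureDensity (averageMeasure G))) := by
  obtain ⟨C, hC, htail⟩ := exists_hellingerSq_tail_le d hd
  refine ⟨C, hC, fun n hn G hG Ω _ P _ X hX hXI S hne hS M hM fhat hf α β hβ hβα hα => ?_⟩
  have hn' : n ≠ 0 := by omega
  have hGbar := isProbabilityMeasure_averageMeasure G hn' hG
  have hmn : 0 < min (1 - α) β := lt_min (by linarith) hβ
  refine ⟨fun hlr => ?_, fun hmle => hmle.mono fun ω hω =>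
    hω.likelihoodRatioBound hn' _ hC.le hβ hβα hα _⟩
  have hZ : ∀ x, hellingerSq (fhat x) (mixtureDensity (averageMeasure G)) ≠ ⊤ := by
    intro x
    obtain ⟨F, hF, hfF⟩ := hf x
    rw [hfF]
    exact ((hellingerSq_le_two (mixtureDensity_nonneg _) (mixtureDensity_nonneg _)
      (continuous_mixtureDensity _).measurable (continuous_mixtureDensity _).measurable
      (lintegral_mixtureDensity _) (lintegral_mixtureDensity _)).trans_lt ENNReal.ofNat_lt_top).ne
  -- For an infinite rate both claims are trivial, because the Hellinger distance is finite.
  by_cases hfin : rateSq n M S (averageMeasure G) = ⊤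
  · refine ⟨fun t ht => ?_, ?_⟩
    · have hempty : {ω | ENNReal.ofReal (t * Real.sqrt C / Real.sqrt (min (1 - α) β)) *
          rate n M S (averageMeasure G) ≤
          hellinger (fhat fun i => X i ω) (mixtureDensity (averageMeasure G))} = ∅ := by
        refine Set.eq_empty_of_forall_notMem fun ω hω => ?_
        have h1 : ENNReal.ofReal (t * Real.sqrt C / Real.sqrt (min (1 - α) β)) *
          rate n M S (averageMeasure G) ≤
          hellinger (fhat fun i => X i ω) (mixtureDensity (averageMeasure G)) := hω
        rw [rate, hfin, ENNReal.top_rpow_of_pos (by norm_num), ENNReal.mul_top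
          (ENNReal.ofReal_pos.2 (by positivity)).ne', top_le_iff, hellinger] at h1
        exact ENNReal.rpow_ne_top_of_nonneg (by norm_num) (hZ _) h1
      rw [hempty, measure_empty]
      exact zero_le
    · rw [hfin, ENNReal.mul_top (ENNReal.ofReal_pos.2 (by positivity)).ne']
      exact le_top
  have hT := fun s hs => htail n hn G hG Ω _ P inferInstance X hX hXI S hne hS M hM
    (fun ω => fhat fun i => X i ω) (fun ω => hf _) α β hβ hβα hα hfin hlr s hs
  refine ⟨fun t ht => ?_, ?_⟩
  -- Squaring the Hellinger event gives the tail event with `s = t²`.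
  · refine le_trans (measure_mono fun ω hω => ?_) (hT (t ^ 2) (one_le_pow₀ ht))
    have h1 := pow_le_pow_left' (show ENNReal.ofReal
      (t * Real.sqrt C / Real.sqrt (min (1 - α) β)) * rate n M S (averageMeasure G) ≤
      hellinger (fhat fun i => X i ω) (mixtureDensity (averageMeasure G)) from hω) 2
    rw [mul_pow, rate, hellinger, rpow_half_sq, rpow_half_sq, ← ENNReal.ofReal_pow (by positivity),
      div_pow, mul_pow, Real.sq_sqrt hC.le, Real.sq_sqrt hmn.le, mul_div_assoc] at h1
    exact h1
  · have hb0 : ENNReal.ofReal (C / min (1 - α) β) * rateSq n M S (averageMeasure G) ≠ 0 :=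
      mul_ne_zero (ENNReal.ofReal_pos.2 (by positivity)).ne' (rateSq_ne_zero hd hn hM hS hne _)
    refine (lintegral_le_of_geometric_tail (fun ω => hZ _) hb0
      (ENNReal.mul_ne_top ENNReal.ofReal_ne_top hfin) fun k => ?_).trans ?_
    · refine le_trans ?_ (two_mul_rpow_neg_le hn k)
      -- The level `k + 1` is the tail event with `s = k + 1`, of probability at most `2 n^(-(k+1))
      -- ≤ 2^(-k)`. Summing gives the constant 3, within the claimed 4.
      refine le_trans (le_of_eq ?_) (hT (k + 1) (by linarith [Nat.cast_nonneg (α := ℝ) k]))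
      rw [ENNReal.ofReal_mul (by positivity), ← Nat.cast_add_one, ENNReal.ofReal_natCast]
      simp_rw [mul_assoc]
    · rw [← mul_assoc, ← ENNReal.ofReal_ofNat 3, ← ENNReal.ofReal_mul (by norm_num)]
      gcongr
      rw [mul_div_assoc]
      have : 0 ≤ C / min (1 - α) β := by positivity
      linarith
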